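/- **Theorem 2.1.** Let $N\ge 1$ be an integer and $0<m<1$. For $x_0\in\mathbb R^N$, $r>0$ let $B(x_0,r)$ be the open ball, $\mathbb S(x_0,r)$ its boundary, and $\sigma$ the surface measure on a sphere; functions are complex valued, $r_+=\max\{0,r\}$, and $B(x_0,0)=\emptyset$. Put $$k=2(1+m)+N(1-m),\qquad \nu=\frac{k}{m+1},$$ and, for $\tau\in\left(\frac{m+1}2,1\right]$, $$\gamma(\tau)=\frac{2\tau-(1+m)}{k},\qquad \mu(\tau)=\frac{2(1-\tau)}{k},\qquad \eta(\tau)=\frac{1-m}{1+m}-\gamma(\tau).$$ Then $\nu>2$, $\gamma(\tau)\in(0,1)$ and $\eta(\tau)>0$ for all such $\tau$, and there is a constant $C=C(N,m)>0$, depending only on $N$ and $m$, and continuously on $m\in(0,1)$, with the following property. Let $x_0\in\mathbb R^N$, $\rho_0>0$ and $u\in H^1_{\mathrm{loc}}(B(x_0,\rho_0))$, and suppose that $L>0$ and $M>0$ are such that for almost every $\rho\in(0,\rho_0)$ $$\|\nabla u\|_{L^2(B(x_0,\rho))}^2+L\|u\|_{L^{m+1}(B(x_0,\rho))}^{m+1}\le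 M\left|\int_{\mathbb S(x_0,\rho)}u\,\overline{\nabla u}\cdot\frac{x-x_0}{|x-x_0|}\,d\sigma\right| .$$ Let $$E(\rho_0)=\|\nabla u\|^2_{L^2(B(x_0,\rho_0))}\in[0,\infty],\qquad b(\rho_0)=\|u\|^{m+1}_{L^{m+1}(B(x_0,\rho_0))}\in[0,\infty].$$ Then the minimum below is attained, and $u=0$ almost everywhere in $B(x_0,\rho_{\max})$, where $\rho_{\max}\ge0$ is given by $$\rho_{\max}^\nu=\left(\rho_0^\nu-CM^2\max\left\{1,\frac1{L^2}\right\}\max\left\{\rho_0^{\nu-1},1\right\}\min_{\tau\in\left(\frac{m+1}2,1\right]}\frac{E(\rho_0)^{\gamma(\tau)}\max\left\{b(\rho_0)^{\mu(\tau)},b(\rho_0)^{\eta(\tau)}\right\}}{2\tau-(1+m)}\right)_+ .$$ (Here $t^0=1$ for all $t\in[0,\infty]$ and $0\cdot\infty=0$; $\rho_{\max}=0$ if the minimum is infinite.) -/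

import Mathlib

open MeasureTheory Set Metric
open scoped ENNReal ContDiff ComplexConjugate

namespace Localization

noncomputable section

/-- `G` is the weak (distributional) gradient on the open set `Ω ⊆ ℝ^N` of `u : ℝ^N → ℂ`:
both are locally integrable on `Ω`, and `∫_Ω u ∂ᵢφ = - ∫_Ω Gᵢ φ` for every test function `φ` in
`C_c^∞(Ω)` and every `i`. (Real test functions suffice, by linearity.) -/
structure IsWeakGradientOn {N : ℕ} (Ω : Set (EuclideanSpace ℝ (Fin N)))
    (u : EuclideanSpace ℝ (Fin N) → ℂ)
    (G : EuclideanSpace ℝ (Fin N) → EuclideanSpace ℂ (Fin N)) : Prop where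
  locallyIntegrableOn : LocallyIntegrableOn u Ω
  locallyIntegrableOn_grad : LocallyIntegrableOn G Ω
  integral_eq : ∀ φ : EuclideanSpace ℝ (Fin N) → ℝ,
    ContDiff ℝ ∞ φ → HasCompactSupport φ → tsupport φ ⊆ Ω → ∀ i : Fin N,
      ∫ x in Ω, u x * (fderiv ℝ φ x (EuclideanSpace.single i 1) : ℂ) = -∫ x in Ω, G x i * (φ x : ℂ)

/-- `u ∈ H¹_loc(Ω)` with weak gradient `G` (which is unique up to a null subset of `Ω`): `u` and
`G` are square integrable on every compact subset of the open set `Ω`. -/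
structure IsH1LocWithGradient {N : ℕ} (Ω : Set (EuclideanSpace ℝ (Fin N)))
    (u : EuclideanSpace ℝ (Fin N) → ℂ)
    (G : EuclideanSpace ℝ (Fin N) → EuclideanSpace ℂ (Fin N)) : Prop where
  memLp : ∀ K ⊆ Ω, IsCompact K → MemLp u 2 (volume.restrict K)
  memLp_grad : ∀ K ⊆ Ω, IsCompact K → MemLp G 2 (volume.restrict K)
  isWeakGradientOn : IsWeakGradientOn Ω u G

/-- The surface measure `σ` on the sphere `S(x₀, ρ)`, `ρ > 0`, as a measure on `ℝ^N`: the image of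
the surface measure of the unit sphere under `y ↦ x₀ + ρ y`, times `ρ^(N-1)`. For `N = 1` it is the
counting measure on the two points `x₀ ± ρ`. -/
def surfaceMeasure {N : ℕ} (x₀ : EuclideanSpace ℝ (Fin N)) (ρ : ℝ) :
    Measure (EuclideanSpace ℝ (Fin N)) :=
  ENNReal.ofReal (ρ ^ (N - 1)) •
    Measure.map (fun y : sphere (0 : EuclideanSpace ℝ (Fin N)) 1 ↦
      x₀ + ρ • (y : EuclideanSpace ℝ (Fin N)))
      (volume : Measure (EuclideanSpace ℝ (Fin N))).toSphere

/-- The flux `∫_{S(x₀,ρ)} u \overline{∇u} · (x - x₀)/|x - x₀| dσ`, where `G = ∇u`. -/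
def boundaryFlux {N : ℕ} (x₀ : EuclideanSpace ℝ (Fin N))
    (u : EuclideanSpace ℝ (Fin N) → ℂ)
    (G : EuclideanSpace ℝ (Fin N) → EuclideanSpace ℂ (Fin N)) (ρ : ℝ) : ℂ :=
  ∫ x, u x * ∑ i, conj (G x i) * (((x - x₀) i / ‖x - x₀‖ : ℝ) : ℂ) ∂(surfaceMeasure x₀ ρ)

/-- `E(ρ) = ‖∇u‖²_{L²(B(x₀,ρ))} ∈ [0, ∞]`, where `G = ∇u`. -/
def energy {N : ℕ} (x₀ : EuclideanSpace ℝ (Fin N))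
    (G : EuclideanSpace ℝ (Fin N) → EuclideanSpace ℂ (Fin N)) (ρ : ℝ) : ℝ≥0∞ :=
  eLpNorm G 2 (volume.restrict (ball x₀ ρ)) ^ 2

/-- `b(ρ) = ‖u‖^{m+1}_{L^{m+1}(B(x₀,ρ))} ∈ [0, ∞]`. -/
def mass {N : ℕ} (m : ℝ) (x₀ : EuclideanSpace ℝ (Fin N))
    (u : EuclideanSpace ℝ (Fin N) → ℂ) (ρ : ℝ) : ℝ≥0∞ :=
  eLpNorm u (ENNReal.ofReal (m + 1)) (volume.restrict (ball x₀ ρ)) ^ (m + 1)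

/-- `k = 2(1+m) + N(1-m)`. -/
def kExp (N : ℕ) (m : ℝ) : ℝ := 2 * (1 + m) + N * (1 - m)

/-- `ν = k/(m+1)`. -/
def nuExp (N : ℕ) (m : ℝ) : ℝ := kExp N m / (m + 1)

/-- `γ(τ) = (2τ - (1+m))/k`. -/
def gammaExp (N : ℕ) (m τ : ℝ) : ℝ := (2 * τ - (1 + m)) / kExp N m

/-- `μ(τ) = 2(1-τ)/k`. -/
def muExp (N : ℕ) (m τ : ℝ) : ℝ := 2 * (1 - τ) / kExp N m

/-- `η(τ) = (1-m)/(1+m) - γ(τ)`. -/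
def etaExp (N : ℕ) (m τ : ℝ) : ℝ := (1 - m) / (1 + m) - gammaExp N m τ

/-- `E^γ(τ) max{b^μ(τ), b^η(τ)} / (2τ - (1+m))`, with values in `[0, ∞]`. -/
def tauTerm (N : ℕ) (m : ℝ) (E b : ℝ≥0∞) (τ : ℝ) : ℝ≥0∞ :=
  E ^ gammaExp N m τ * max (b ^ muExp N m τ) (b ^ etaExp N m τ) /
    ENNReal.ofReal (2 * τ - (1 + m))

/-- The radius `ρ_max ≥ 0` such that `ρ_max^ν` is the positive part of
`ρ₀^ν - C M² max{1, 1/L²} max{ρ₀^(ν-1), 1} min_τ tauTerm(τ)`, the minimum being over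
`τ ∈ ((m+1)/2, 1]`. The subtraction of `ℝ≥0∞` is the positive part of the difference; in
particular `ρ_max = 0` if the minimum is infinite (and `C, M > 0`). -/
def rhoMax (N : ℕ) (m C ρ₀ L M : ℝ) (E b : ℝ≥0∞) : ℝ :=
  (ENNReal.ofReal (ρ₀ ^ nuExp N m) -
    ENNReal.ofReal (C * M ^ 2 * max 1 (1 / L ^ 2) * max (ρ₀ ^ (nuExp N m - 1)) 1) *
      ⨅ τ ∈ Ioc ((m + 1) / 2) 1, tauTerm N m E b τ).toReal ^ (1 / nuExp N m)

end

end Localization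

/-! This is an energy method. Write E(r), b(r) for the energy and mass on B(x₀,r), and e(r) for the
integral of |∇u|² over the sphere of radius r. In polar coordinates E is the integral of e, so E' =
e almost everywhere. The flux hypothesis and Cauchy–Schwarz on the sphere give (E + Lb)² ≤ M² T e,
where T is the integral of |u|² over the sphere.

The analytic core is the interpolation-trace inequality T ≤ K b^(2/k) (E + r^(-ν)
b^(2/(m+1)))^(1-1/ν), with K depending on N only
(`IsH1LocWithGradient.ae_lintegral_surfaceMeasure_le`). For C¹ functions, integrating the derivative
of s^N |v|² along rays bounds T by the L² norms of v and ∇v on the ball. A Nash inequality with a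
free scale (`lintegral_ball_enorm_sq_le`) then bounds the L² norm of v by E and b, and the scale is
optimised. Mollification and Fatou's lemma carry the result over to H¹_loc on almost every sphere.

For each τ, part of the power of b is frozen at ρ₀ and the rest is absorbed into (E+b)^(1+γ)
(`rpow_add_mul_rpow_le`). Cancelling against (E+b)² leaves r^(ν-1) E^(1-γ) ≤ C' e. As long as E > 0
this integrates to γ(ρ₀^ν - a^ν) ≤ ν C' E(ρ₀)^γ, so E(a) > 0 forces a ≥ ρ_max. Below ρ_max the
gradient therefore vanishes, hence so does the flux, and the hypothesis itself makes the mass zero.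

The constant can be chosen independent of m, because νk ≤ (N+2)(N+4) and K does not involve m. -/

namespace Localization

/-! ### Polar coordinates and surface measures. -/

section Polar

variable {N : ℕ}

theorem lintegral_surfaceMeasure (x₀ : EuclideanSpace ℝ (Fin N)) (ρ : ℝ)
    {f : EuclideanSpace ℝ (Fin N) → ℝ≥0∞} (hf : Measurable f) :
    ∫⁻ x, f x ∂(surfaceMeasure x₀ ρ) = ENNReal.ofReal (ρ ^ (N - 1)) *
      ∫⁻ y : sphere (0 : EuclideanSpace ℝ (Fin N)) 1, f (x₀ + ρ • (y : EuclideanSpace ℝ (Fin N)))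
        ∂((volume : Measure (EuclideanSpace ℝ (Fin N))).toSphere) := by
  rw [surfaceMeasure, lintegral_smul_measure, lintegral_map hf (by fun_prop), smul_eq_mul]

theorem measurable_lintegral_surfaceMeasure (x₀ : EuclideanSpace ℝ (Fin N))
    {f : EuclideanSpace ℝ (Fin N) → ℝ≥0∞} (hf : Measurable f) :
    Measurable fun ρ ↦ ∫⁻ x, f x ∂(surfaceMeasure x₀ ρ) := by
  simp_rw [lintegral_surfaceMeasure x₀ _ hf]
  refine Measurable.mul (by fun_prop) (Measurable.lintegral_prod_right' (f := fun z : ℝ ×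
    sphere (0 : EuclideanSpace ℝ (Fin N)) 1 ↦ f (x₀ + z.1 • (z.2 : EuclideanSpace ℝ (Fin N)))) ?_)
  fun_prop

/-- The punctured space is the unit sphere times (0,∞), with radial density r^(N-1); that density is
the scaling factor built into `surfaceMeasure`. Positivity of N makes the removed origin a null set.
-/
theorem lintegral_eq_lintegral_surfaceMeasure (hN : 0 < N) (x₀ : EuclideanSpace ℝ (Fin N))
    {f : EuclideanSpace ℝ (Fin N) → ℝ≥0∞} (hf : Measurable f) :
    ∫⁻ x, f x = ∫⁻ r in Ioi (0 : ℝ), ∫⁻ x, f x ∂(surfaceMeasure x₀ r) := by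
  have : Nonempty (Fin N) := ⟨⟨0, hN⟩⟩
  have hg : Measurable fun x ↦ f (x₀ + x) := by fun_prop
  calc ∫⁻ x, f x = ∫⁻ x, f (x₀ + x) := (lintegral_add_left_eq_self f x₀).symm
    _ = ∫⁻ x : ({0}ᶜ : Set (EuclideanSpace ℝ (Fin N))), f (x₀ + x)
          ∂(volume.comap Subtype.val) := by
      rw [lintegral_subtype_comap (measurableSet_singleton _).compl fun x ↦ f (x₀ + x),
        restrict_compl_singleton]
    _ = ∫⁻ z, f (x₀ + z.2.1 • z.1.1) ∂((volume : Measure (EuclideanSpace ℝ (Fin N))).toSphere.prod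
          (.volumeIoiPow (N - 1))) := by
      have := (volume : Measure (EuclideanSpace ℝ (Fin N))).measurePreserving_homeomorphUnitSphereProd
      rw [finrank_euclideanSpace_fin] at this
      rw [← this.lintegral_comp (by fun_prop)]
      refine lintegral_congr fun x ↦ ?_
      have hx : ‖(x : EuclideanSpace ℝ (Fin N))‖ ≠ 0 := norm_ne_zero_iff.2 x.2
      simp [smul_smul, hx]
    _ = ∫⁻ r : Ioi (0 : ℝ), ∫⁻ y : sphere (0 : EuclideanSpace ℝ (Fin N)) 1, f (x₀ + r.1 • y.1)
          ∂((volume : Measure (EuclideanSpace ℝ (Fin N))).toSphere) ∂(.volumeIoiPow (N - 1)) := by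
      rw [lintegral_prod_symm' _ (by fun_prop)]
    _ = ∫⁻ r : Ioi (0 : ℝ), ∫⁻ x, f x ∂(surfaceMeasure x₀ r.1) ∂(volume.comap Subtype.val) := by
      rw [Measure.volumeIoiPow, lintegral_withDensity_eq_lintegral_mul _ (by fun_prop)]
      · refine lintegral_congr fun r ↦ ?_
        rw [lintegral_surfaceMeasure _ _ hf, Pi.mul_apply]
      · refine Measurable.lintegral_prod_right' (f := fun z : Ioi (0 : ℝ) ×
          sphere (0 : EuclideanSpace ℝ (Fin N)) 1 ↦ f (x₀ + z.1.1 • z.2.1)) ?_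
        fun_prop
    _ = _ := lintegral_subtype_comap measurableSet_Ioi
          fun r : ℝ ↦ ∫⁻ x, f x ∂(surfaceMeasure x₀ r)

theorem ae_surfaceMeasure_dist_eq (x₀ : EuclideanSpace ℝ (Fin N)) {ρ : ℝ} (hρ : 0 ≤ ρ) :
    ∀ᵐ x ∂(surfaceMeasure x₀ ρ), dist x x₀ = ρ := by
  refine Measure.ae_smul_measure ?_ _
  rw [ae_map_iff (by fun_prop) (measurableSet_eq_fun (by fun_prop) (by fun_prop))]
  refine ae_of_all _ fun y ↦ ?_
  simp [norm_smul, abs_of_nonneg hρ]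

theorem setLIntegral_ball_eq_lintegral_surfaceMeasure (hN : 0 < N) (x₀ : EuclideanSpace ℝ (Fin N))
    (ρ : ℝ) {f : EuclideanSpace ℝ (Fin N) → ℝ≥0∞} (hf : Measurable f) :
    ∫⁻ x in ball x₀ ρ, f x = ∫⁻ r in Ioo 0 ρ, ∫⁻ x, f x ∂(surfaceMeasure x₀ r) := by
  rw [← lintegral_indicator measurableSet_ball,
    lintegral_eq_lintegral_surfaceMeasure hN x₀ (hf.indicator measurableSet_ball),
    ← Ioi_inter_Iio, inter_comm, ← setLIntegral_indicator measurableSet_Iio]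
  refine setLIntegral_congr_fun measurableSet_Ioi fun r (hr : 0 < r) ↦ ?_
  by_cases h : r < ρ
  · rw [indicator_of_mem (by exact h)]
    refine lintegral_congr_ae ?_
    filter_upwards [ae_surfaceMeasure_dist_eq x₀ hr.le] with x hx
    rw [indicator_of_mem (by simpa [hx] using h)]
  · rw [indicator_of_notMem (by exact h)]
    refine (lintegral_congr_ae ?_).trans lintegral_zero
    filter_upwards [ae_surfaceMeasure_dist_eq x₀ hr.le] with x hx
    rw [indicator_of_notMem (by simpa [hx] using h)]

/-- By the polar formula, a Lebesgue null set meets almost every sphere in a σ-null set. This gives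
meaning to sphere integrals of functions determined only up to null sets. -/
theorem ae_surfaceMeasure_of_ae_ball (hN : 0 < N) (x₀ : EuclideanSpace ℝ (Fin N)) (ρ : ℝ)
    {P : EuclideanSpace ℝ (Fin N) → Prop} (h : ∀ᵐ x ∂(volume.restrict (ball x₀ ρ)), P x) :
    ∀ᵐ r ∂(volume.restrict (Ioo 0 ρ)), ∀ᵐ x ∂(surfaceMeasure x₀ r), P x := by
  obtain ⟨t, ht, htm, ht0⟩ := exists_measurable_superset_of_null (ae_iff.1 h)
  have h1 := setLIntegral_ball_eq_lintegral_surfaceMeasure hN x₀ ρ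
    (f := t.indicator 1) (measurable_one.indicator htm)
  rw [lintegral_indicator_one htm, ht0, eq_comm, lintegral_eq_zero_iff
    (measurable_lintegral_surfaceMeasure x₀ (measurable_one.indicator htm))] at h1
  filter_upwards [h1] with r hr
  rw [lintegral_indicator_one htm] at hr
  exact measure_mono_null ht hr

theorem aemeasurable_surfaceMeasure (hN : 0 < N) (x₀ : EuclideanSpace ℝ (Fin N)) (ρ : ℝ)
    {β : Type*} [MeasurableSpace β] {f : EuclideanSpace ℝ (Fin N) → β}
    (hf : AEMeasurable f (volume.restrict (ball x₀ ρ))) :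
    ∀ᵐ r ∂(volume.restrict (Ioo 0 ρ)), AEMeasurable f (surfaceMeasure x₀ r) := by
  filter_upwards [ae_surfaceMeasure_of_ae_ball hN x₀ ρ hf.ae_eq_mk] with r hr
  exact ⟨_, hf.measurable_mk, hr⟩

theorem setLIntegral_ball_eq_lintegral_surfaceMeasure₀ (hN : 0 < N)
    (x₀ : EuclideanSpace ℝ (Fin N)) (ρ : ℝ) {f : EuclideanSpace ℝ (Fin N) → ℝ≥0∞}
    (hf : AEMeasurable f (volume.restrict (ball x₀ ρ))) :
    ∫⁻ x in ball x₀ ρ, f x = ∫⁻ r in Ioo 0 ρ, ∫⁻ x, f x ∂(surfaceMeasure x₀ r) := by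
  rw [lintegral_congr_ae hf.ae_eq_mk,
    setLIntegral_ball_eq_lintegral_surfaceMeasure hN x₀ ρ hf.measurable_mk]
  refine lintegral_congr_ae ?_
  filter_upwards [ae_surfaceMeasure_of_ae_ball hN x₀ ρ hf.ae_eq_mk] with r hr
  exact lintegral_congr_ae (hr.mono fun x hx ↦ hx.symm)

theorem aemeasurable_lintegral_surfaceMeasure (hN : 0 < N)
    (x₀ : EuclideanSpace ℝ (Fin N)) (ρ : ℝ) {f : EuclideanSpace ℝ (Fin N) → ℝ≥0∞}
    (hf : AEMeasurable f (volume.restrict (ball x₀ ρ))) :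
    AEMeasurable (fun r ↦ ∫⁻ x, f x ∂(surfaceMeasure x₀ r)) (volume.restrict (Ioo 0 ρ)) := by
  refine ⟨_, measurable_lintegral_surfaceMeasure x₀ hf.measurable_mk, ?_⟩
  filter_upwards [ae_surfaceMeasure_of_ae_ball hN x₀ ρ hf.ae_eq_mk] with r hr
  exact lintegral_congr_ae hr

end Polar

/-! ### Sphere integrals of C¹ functions, by integration along rays. -/

section Trace

variable {N : ℕ}

/-- This is the fundamental theorem of calculus for s^N |v(x₀+sy)|². The weight kills the
contribution of the centre, and one factor s ≤ ρ is given up in the gradient term so that the polar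
density s^(N-1) factors out. -/
theorem pow_mul_enorm_sq_le_lintegral_ray (hN : 0 < N) (x₀ : EuclideanSpace ℝ (Fin N))
    {ρ : ℝ} (hρ : 0 < ρ) {v : EuclideanSpace ℝ (Fin N) → ℂ} (hv : ContDiff ℝ 1 v)
    {y : EuclideanSpace ℝ (Fin N)} (hy : ‖y‖ = 1) :
    ENNReal.ofReal (ρ ^ N) * ‖v (x₀ + ρ • y)‖ₑ ^ 2 ≤
      ∫⁻ s in Icc 0 ρ, ENNReal.ofReal (s ^ (N - 1)) * (N * ‖v (x₀ + s • y)‖ₑ ^ 2 +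
        2 * ENNReal.ofReal ρ * (‖v (x₀ + s • y)‖ₑ * ‖fderiv ℝ v (x₀ + s • y)‖ₑ)) := by
  have hw : ContDiff ℝ 1 fun s : ℝ ↦ v (x₀ + s • y) := by fun_prop
  have hw' (s : ℝ) : HasDerivAt (fun s : ℝ ↦ v (x₀ + s • y)) (fderiv ℝ v (x₀ + s • y) y) s := by
    have h1 : HasDerivAt (fun s : ℝ ↦ x₀ + s • y) y s := by
      simpa using ((hasDerivAt_id s).smul_const y).const_add x₀
    exact ((hv.differentiable one_ne_zero _).hasFDerivAt).comp_hasDerivAt s h1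
  have hg : ContDiff ℝ 1 fun s : ℝ ↦ s ^ N * ‖v (x₀ + s • y)‖ ^ 2 :=
    (contDiff_id.pow N).mul (hw.norm_sq ℝ)
  have hg' (s : ℝ) : HasDerivAt (fun s : ℝ ↦ s ^ N * ‖v (x₀ + s • y)‖ ^ 2)
      (N * s ^ (N - 1) * ‖v (x₀ + s • y)‖ ^ 2 +
        s ^ N * (2 * inner ℝ (v (x₀ + s • y)) (fderiv ℝ v (x₀ + s • y) y))) s :=
    (hasDerivAt_pow N s).mul (hw' s).norm_sq
  have key := enorm_sub_le_lintegral_deriv_of_contDiffOn_Icc hg.contDiffOn hρ.le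
  have e1 : ‖ρ ^ N * ‖v (x₀ + ρ • y)‖ ^ 2 - 0 ^ N * ‖v (x₀ + (0 : ℝ) • y)‖ ^ 2‖ₑ =
      ENNReal.ofReal (ρ ^ N) * ‖v (x₀ + ρ • y)‖ₑ ^ 2 := by
    rw [zero_pow hN.ne', zero_mul, sub_zero, Real.enorm_of_nonneg (by positivity),
      ENNReal.ofReal_mul (by positivity), ENNReal.ofReal_pow (norm_nonneg _), ofReal_norm]
  rw [e1] at key
  refine key.trans (setLIntegral_mono' measurableSet_Icc fun s hs ↦ ?_)
  rw [(hg' s).deriv]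
  have h2 : ‖(N * s ^ (N - 1) * ‖v (x₀ + s • y)‖ ^ 2 +
        s ^ N * (2 * inner ℝ (v (x₀ + s • y)) (fderiv ℝ v (x₀ + s • y) y)))‖ ≤
      s ^ (N - 1) * (N * ‖v (x₀ + s • y)‖ ^ 2 +
        2 * ρ * (‖v (x₀ + s • y)‖ * ‖fderiv ℝ v (x₀ + s • y)‖)) := by
    have h3 : ‖inner ℝ (v (x₀ + s • y)) (fderiv ℝ v (x₀ + s • y) y)‖ ≤
        ‖v (x₀ + s • y)‖ * ‖fderiv ℝ v (x₀ + s • y)‖ := by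
      refine (norm_inner_le_norm _ _).trans ?_
      gcongr
      simpa [hy] using (fderiv ℝ v (x₀ + s • y)).le_opNorm y
    have h4 : s ^ N ≤ s ^ (N - 1) * ρ := by
      obtain ⟨n, rfl⟩ := Nat.exists_eq_succ_of_ne_zero hN.ne'
      rw [Nat.succ_eq_add_one, Nat.add_sub_cancel, pow_succ]
      have := hs.1
      gcongr
      exact hs.2
    have hs0 := hs.1
    refine (norm_add_le _ _).trans ?_
    simp only [norm_mul, norm_pow, Real.norm_natCast, norm_norm, Real.norm_of_nonneg hs0,
      Real.norm_ofNat]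
    calc _ ≤ N * s ^ (N - 1) * ‖v (x₀ + s • y)‖ ^ 2 + (s ^ (N - 1) * ρ) *
            (2 * (‖v (x₀ + s • y)‖ * ‖fderiv ℝ v (x₀ + s • y)‖)) := by gcongr
      _ = _ := by ring
  rw [← ofReal_norm]
  refine (ENNReal.ofReal_le_ofReal h2).trans_eq ?_
  have hs0 := hs.1
  rw [ENNReal.ofReal_mul (by positivity), ENNReal.ofReal_add (by positivity) (by positivity),
    ENNReal.ofReal_mul (by positivity), ENNReal.ofReal_mul (by positivity),
    ENNReal.ofReal_mul (by positivity), ENNReal.ofReal_mul (by positivity),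
    ENNReal.ofReal_pow (norm_nonneg _), ofReal_norm, ofReal_norm]
  simp

theorem lintegral_surfaceMeasure_enorm_sq_le (hN : 0 < N) (x₀ : EuclideanSpace ℝ (Fin N))
    {ρ : ℝ} (hρ : 0 < ρ) {v : EuclideanSpace ℝ (Fin N) → ℂ} (hv : ContDiff ℝ 1 v) :
    ENNReal.ofReal ρ * ∫⁻ x, ‖v x‖ₑ ^ 2 ∂(surfaceMeasure x₀ ρ) ≤
      N * (∫⁻ x in ball x₀ ρ, ‖v x‖ₑ ^ 2) +
        2 * ENNReal.ofReal ρ * ∫⁻ x in ball x₀ ρ, ‖v x‖ₑ * ‖fderiv ℝ v x‖ₑ := by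
  have hc : Continuous v := hv.continuous
  have hc' : Continuous (fderiv ℝ v) := hv.continuous_fderiv one_ne_zero
  set F : EuclideanSpace ℝ (Fin N) → ℝ≥0∞ := fun x ↦ N * ‖v x‖ₑ ^ 2 +
    2 * ENNReal.ofReal ρ * (‖v x‖ₑ * ‖fderiv ℝ v x‖ₑ) with hF
  have m1 : Measurable fun x ↦ ‖v x‖ₑ ^ 2 := by fun_prop
  have m2 : Measurable fun x ↦ ‖v x‖ₑ * ‖fderiv ℝ v x‖ₑ :=
    hc.enorm.measurable.mul hc'.enorm.measurable
  have m3 : Measurable F := (m1.const_mul _).add (m2.const_mul _)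
  have hsum : N * (∫⁻ x in ball x₀ ρ, ‖v x‖ₑ ^ 2) +
      2 * ENNReal.ofReal ρ * (∫⁻ x in ball x₀ ρ, ‖v x‖ₑ * ‖fderiv ℝ v x‖ₑ) =
      ∫⁻ x in ball x₀ ρ, F x := by
    rw [lintegral_add_left (m1.const_mul _), lintegral_const_mul _ m1, lintegral_const_mul _ m2]
  rw [hsum, setLIntegral_ball_eq_lintegral_surfaceMeasure hN x₀ ρ m3,
    lintegral_surfaceMeasure _ _ m1, ← mul_assoc, ← ENNReal.ofReal_mul hρ.le, mul_comm ρ,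
    ← pow_succ, Nat.sub_add_cancel hN, ← lintegral_const_mul _
      (by exact m1.comp (by fun_prop))]
  calc _ ≤ ∫⁻ y : sphere (0 : EuclideanSpace ℝ (Fin N)) 1, (∫⁻ s in Icc (0 : ℝ) ρ,
          ENNReal.ofReal (s ^ (N - 1)) * F (x₀ + s • y.1))
          ∂((volume : Measure (EuclideanSpace ℝ (Fin N))).toSphere) :=
        lintegral_mono fun y ↦ pow_mul_enorm_sq_le_lintegral_ray hN x₀ hρ hv (by simp)
    _ = ∫⁻ s in Icc (0 : ℝ) ρ, ∫⁻ y : sphere (0 : EuclideanSpace ℝ (Fin N)) 1,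
          ENNReal.ofReal (s ^ (N - 1)) * F (x₀ + s • y.1)
          ∂((volume : Measure (EuclideanSpace ℝ (Fin N))).toSphere) := by
        rw [lintegral_lintegral_swap]
        fun_prop
    _ = ∫⁻ s in Ioo 0 ρ, ∫⁻ x, F x ∂(surfaceMeasure x₀ s) := by
        rw [restrict_Ioo_eq_restrict_Icc]
        refine lintegral_congr fun s ↦ ?_
        rw [lintegral_surfaceMeasure _ _ m3, lintegral_const_mul _ (by fun_prop)]

end Trace

/-! ### A Nash inequality on balls. -/

section Nash

variable {N : ℕ}

theorem rpow_lintegral_le_lintegral_rpow {α : Type*} [MeasurableSpace α] (μ : Measure α)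
    [IsProbabilityMeasure μ] {f : α → ℝ≥0∞} (hf : AEMeasurable f μ) {q : ℝ} (hq : 1 ≤ q) :
    (∫⁻ x, f x ∂μ) ^ q ≤ ∫⁻ x, f x ^ q ∂μ := by
  rcases hq.eq_or_lt with rfl | hq
  · simp
  have h := ENNReal.lintegral_mul_le_Lp_mul_Lq μ (Real.HolderConjugate.conjExponent hq) hf
    (aemeasurable_const (b := (1 : ℝ≥0∞)))
  simp only [Pi.mul_apply, mul_one, ENNReal.one_rpow, lintegral_const, measure_univ] at h
  calc (∫⁻ x, f x ∂μ) ^ q ≤ ((∫⁻ x, f x ^ q ∂μ) ^ (1 / q)) ^ q := by gcongr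
    _ = _ := by rw [← ENNReal.rpow_mul, one_div_mul_cancel (by linarith), ENNReal.rpow_one]

theorem sq_lintegral_mul_le {α : Type*} [MeasurableSpace α] (μ : Measure α)
    {f g : α → ℝ≥0∞} (hf : AEMeasurable f μ) (hg : AEMeasurable g μ) :
    (∫⁻ x, f x * g x ∂μ) ^ 2 ≤ (∫⁻ x, f x ^ 2 ∂μ) * ∫⁻ x, g x ^ 2 ∂μ := by
  have h := ENNReal.lintegral_mul_le_Lp_mul_Lq μ Real.HolderConjugate.two_two hf hg
  simp only [Pi.mul_apply] at h
  calc _ ≤ ((∫⁻ x, f x ^ (2 : ℝ) ∂μ) ^ (1 / (2 : ℝ)) *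
          (∫⁻ x, g x ^ (2 : ℝ) ∂μ) ^ (1 / (2 : ℝ))) ^ 2 := by gcongr
    _ = _ := by
      rw [← ENNReal.rpow_natCast, ENNReal.mul_rpow_of_nonneg _ _ (by simp), ← ENNReal.rpow_mul,
        ← ENNReal.rpow_mul]
      simp

theorem sq_lintegral_le {α : Type*} [MeasurableSpace α] (μ : Measure α)
    {f : α → ℝ≥0∞} (hf : AEMeasurable f μ) :
    (∫⁻ x, f x ∂μ) ^ 2 ≤ μ univ * ∫⁻ x, f x ^ 2 ∂μ := by
  simpa using sq_lintegral_mul_le μ (aemeasurable_const (b := (1 : ℝ≥0∞))) hf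

/-- A ball is convex, so a contraction towards one of its points maps it into itself. Hence f may be
cut off outside the ball before changing variables on the whole space, with Jacobian c^N. -/
theorem setLIntegral_ball_comp_contraction_le (x₀ : EuclideanSpace ℝ (Fin N)) {ρ c : ℝ}
    (hc : c ∈ Ioc (0 : ℝ) 1) {z : EuclideanSpace ℝ (Fin N)} (hz : z ∈ ball x₀ ρ)
    {f : EuclideanSpace ℝ (Fin N) → ℝ≥0∞} (hf : Measurable f) :
    ∫⁻ x in ball x₀ ρ, f (z + c • (x - z)) ≤
      ENNReal.ofReal ((c ^ N)⁻¹) * ∫⁻ x in ball x₀ ρ, f x := by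
  have hF := hf.indicator (measurableSet_ball (x := x₀) (ε := ρ))
  set F := (ball x₀ ρ).indicator f
  calc _ = ∫⁻ x in ball x₀ ρ, F (z + c • (x - z)) := by
        refine setLIntegral_congr_fun measurableSet_ball fun x hx ↦ ?_
        simp only [F]
        rw [indicator_of_mem]
        exact (convex_ball x₀ ρ).add_smul_sub_mem hz hx ⟨hc.1.le, hc.2⟩
    _ ≤ ∫⁻ x, F (z + c • (x - z)) := setLIntegral_le_lintegral _ _
    _ = ∫⁻ x, F (z + c • x) := lintegral_sub_right_eq_self (fun x ↦ F (z + c • x)) z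
    _ = ∫⁻ x, F (z + x) ∂(Measure.map (c • ·) volume) :=
        (lintegral_map (f := fun x ↦ F (z + x)) (hF.comp (measurable_const_add z))
          (measurable_const_smul c)).symm
    _ = ENNReal.ofReal ((c ^ N)⁻¹) * ∫⁻ x, F (z + x) := by
        have := hc.1
        rw [Measure.map_addHaar_smul _ hc.1.ne', lintegral_smul_measure, smul_eq_mul,
          finrank_euclideanSpace_fin, abs_of_nonneg (by positivity)]
    _ = _ := by
        rw [lintegral_add_left_eq_self, lintegral_indicator measurableSet_ball]

/-- Integrate the derivative along the segment; Cauchy–Schwarz in the parameter produces the factor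
t. -/
theorem enorm_sub_sq_le_lintegral_segment {v : EuclideanSpace ℝ (Fin N) → ℂ}
    (hv : ContDiff ℝ 1 v) (x y : EuclideanSpace ℝ (Fin N)) {t : ℝ} (ht : 0 ≤ t) :
    ‖v x - v (x + t • (y - x))‖ₑ ^ 2 ≤ ‖y - x‖ₑ ^ 2 *
      (ENNReal.ofReal t * ∫⁻ s in Icc 0 t, ‖fderiv ℝ v (x + s • (y - x))‖ₑ ^ 2) := by
  have hc' : Continuous (fderiv ℝ v) := hv.continuous_fderiv one_ne_zero
  have hw : ContDiff ℝ 1 fun s : ℝ ↦ v (x + s • (y - x)) := by fun_prop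
  have hw' (s : ℝ) : HasDerivAt (fun s : ℝ ↦ v (x + s • (y - x)))
      (fderiv ℝ v (x + s • (y - x)) (y - x)) s := by
    have h1 : HasDerivAt (fun s : ℝ ↦ x + s • (y - x)) (y - x) s := by
      simpa using ((hasDerivAt_id s).smul_const (y - x)).const_add x
    exact ((hv.differentiable one_ne_zero _).hasFDerivAt).comp_hasDerivAt s h1
  have key := enorm_sub_le_lintegral_deriv_of_contDiffOn_Icc hw.contDiffOn ht
  simp only [zero_smul, add_zero] at key
  have m : Measurable fun s : ℝ ↦ ‖fderiv ℝ v (x + s • (y - x))‖ₑ :=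
    (hc'.comp (by fun_prop)).enorm.measurable
  calc _ ≤ (∫⁻ s in Icc 0 t, ‖y - x‖ₑ * ‖fderiv ℝ v (x + s • (y - x))‖ₑ) ^ 2 := by
        rw [← edist_eq_enorm_sub, edist_comm, edist_eq_enorm_sub]
        gcongr
        refine key.trans (lintegral_mono fun s ↦ ?_)
        rw [(hw' s).deriv, mul_comm]
        exact (fderiv ℝ v _).le_opENorm _
    _ ≤ _ := by
        rw [lintegral_const_mul _ m, mul_pow]
        gcongr
        refine (sq_lintegral_le _ m.aemeasurable).trans_eq ?_
        simp

/-- For fixed y and s ≤ t ≤ 1/2, the point x + s(y-x) is the image of x under a contraction towards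
y of ratio 1-s ≥ 1/2, so the change of variables costs at most 2^N. The remaining factor (2ρ)² t · t
comes from |y-x| ≤ 2ρ, the segment estimate and the length of the s-interval. -/
theorem lintegral_ball_sub_contraction_le (x₀ : EuclideanSpace ℝ (Fin N)) {ρ t : ℝ}
    (ht : t ∈ Ioc (0 : ℝ) (1 / 2)) {v : EuclideanSpace ℝ (Fin N) → ℂ} (hv : ContDiff ℝ 1 v)
    {y : EuclideanSpace ℝ (Fin N)} (hy : y ∈ ball x₀ ρ) :
    ∫⁻ x in ball x₀ ρ, ‖v x - v (x + t • (y - x))‖ₑ ^ 2 ≤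
      ENNReal.ofReal (2 ^ (N + 2) * (ρ * t) ^ 2) * ∫⁻ x in ball x₀ ρ, ‖fderiv ℝ v x‖ₑ ^ 2 := by
  have hc' : Continuous (fderiv ℝ v) := hv.continuous_fderiv one_ne_zero
  have ht0 := ht.1
  have hρ : 0 < ρ := pos_of_mem_ball hy
  have m : Measurable fun z : EuclideanSpace ℝ (Fin N) × ℝ ↦
      ‖fderiv ℝ v (z.1 + z.2 • (y - z.1))‖ₑ ^ 2 :=
    ((hc'.comp (by fun_prop)).enorm.measurable).pow_const 2
  calc _ ≤ ∫⁻ x in ball x₀ ρ, ENNReal.ofReal ((2 * ρ) ^ 2 * t) *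
          ∫⁻ s in Icc 0 t, ‖fderiv ℝ v (x + s • (y - x))‖ₑ ^ 2 := by
        refine setLIntegral_mono' measurableSet_ball fun x hx ↦ ?_
        refine (enorm_sub_sq_le_lintegral_segment hv x y ht0.le).trans ?_
        rw [ENNReal.ofReal_mul (by positivity), mul_assoc, ENNReal.ofReal_pow (by positivity),
          ← ofReal_norm]
        gcongr
        rw [← dist_eq_norm]
        rw [mem_ball] at hx hy
        linarith [dist_triangle_right y x x₀]
    _ = ENNReal.ofReal ((2 * ρ) ^ 2 * t) * ∫⁻ s in Icc 0 t, ∫⁻ x in ball x₀ ρ,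
          ‖fderiv ℝ v (x + s • (y - x))‖ₑ ^ 2 := by
        rw [lintegral_const_mul _ m.lintegral_prod_right', lintegral_lintegral_swap m.aemeasurable]
    _ ≤ ENNReal.ofReal ((2 * ρ) ^ 2 * t) * ∫⁻ s in Icc 0 t, (ENNReal.ofReal (2 ^ N) *
          ∫⁻ x in ball x₀ ρ, ‖fderiv ℝ v x‖ₑ ^ 2) := by
        gcongr ENNReal.ofReal ((2 * ρ) ^ 2 * t) * ?_
        refine setLIntegral_mono' measurableSet_Icc fun s hs ↦ ?_
        have hs2 : 1 / 2 ≤ 1 - s := by linarith [ht.2, hs.2]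
        have h := setLIntegral_ball_comp_contraction_le x₀ (c := 1 - s)
          ⟨by linarith, by linarith [hs.1]⟩ hy (hc'.enorm.measurable.pow_const 2)
        calc _ = ∫⁻ x in ball x₀ ρ, ‖fderiv ℝ v (y + (1 - s) • (x - y))‖ₑ ^ 2 := by
              refine lintegral_congr fun x ↦ ?_
              rw [show x + s • (y - x) = y + (1 - s) • (x - y) by module]
          _ ≤ _ := h
          _ ≤ _ := by
              gcongr
              rw [← inv_pow]
              gcongr
              rw [inv_le_comm₀ (by linarith) (by norm_num)]
              linarith
    _ = _ := by
        rw [lintegral_const, Measure.restrict_apply MeasurableSet.univ, univ_inter, Real.volume_Icc,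
          sub_zero, mul_comm _ (ENNReal.ofReal t), ← mul_assoc, ← mul_assoc,
          ← ENNReal.ofReal_mul (by positivity), ← ENNReal.ofReal_mul (by positivity)]
        ring_nf

/-- Nash's inequality on a ball, with a free scale `t`. -/
theorem lintegral_ball_enorm_sq_le (x₀ : EuclideanSpace ℝ (Fin N)) {ρ t p : ℝ}
    (hρ : 0 < ρ) (ht : t ∈ Ioc (0 : ℝ) (1 / 2)) (hp : p ∈ Icc (1 : ℝ) 2)
    {v : EuclideanSpace ℝ (Fin N) → ℂ} (hv : ContDiff ℝ 1 v) :
    ∫⁻ x in ball x₀ ρ, ‖v x‖ₑ ^ 2 ≤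
      2 * (ENNReal.ofReal (2 ^ (N + 2) * (ρ * t) ^ 2) * ∫⁻ x in ball x₀ ρ, ‖fderiv ℝ v x‖ₑ ^ 2) +
      2 * (((volume (ball x₀ ρ))⁻¹ * (ENNReal.ofReal ((t ^ N)⁻¹) *
        ∫⁻ x in ball x₀ ρ, ‖v x‖ₑ ^ p)) ^ (2 / p - 1) *
          (ENNReal.ofReal (2 ^ N) * ∫⁻ x in ball x₀ ρ, ‖v x‖ₑ ^ p)) := by
  have ht0 := ht.1
  have hp0 : 0 < p := by linarith [hp.1]
  have hc : Continuous v := hv.continuous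
  have hV0 : volume (ball x₀ ρ) ≠ 0 := (measure_ball_pos _ _ hρ).ne'
  have hV1 : volume (ball x₀ ρ) ≠ ⊤ := measure_ball_lt_top.ne
  set π : Measure (EuclideanSpace ℝ (Fin N)) :=
    (volume (ball x₀ ρ))⁻¹ • volume.restrict (ball x₀ ρ) with hπ
  have : IsProbabilityMeasure π := ⟨by simp [hπ, ENNReal.inv_mul_cancel hV0 hV1]⟩
  have hπB : ∀ᵐ y ∂π, y ∈ ball x₀ ρ := Measure.ae_smul_measure (ae_restrict_mem measurableSet_ball) _
  set b := ∫⁻ x in ball x₀ ρ, ‖v x‖ₑ ^ p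
  set E := ∫⁻ x in ball x₀ ρ, ‖fderiv ℝ v x‖ₑ ^ 2
  have mvp : Measurable fun x ↦ ‖v x‖ₑ ^ p := by fun_prop
  -- The value v(x) is compared with its average over the shrunken ball x + t(y-x), y uniform in the
  -- ball. J is the corresponding average of |v|^p. Contracting in y bounds J pointwise at the price
  -- t^(-N); contracting in x bounds its integral at the price 2^N.
  set J : EuclideanSpace ℝ (Fin N) → ℝ≥0∞ := fun x ↦ ∫⁻ y, ‖v (x + t • (y - x))‖ₑ ^ p ∂π with hJ
  have mJ : Measurable fun z : EuclideanSpace ℝ (Fin N) × EuclideanSpace ℝ (Fin N) ↦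
    ‖v (z.1 + t • (z.2 - z.1))‖ₑ ^ p :=
    (Continuous.enorm (by fun_prop)).measurable.pow_const p
  have mD : Measurable fun z : EuclideanSpace ℝ (Fin N) × EuclideanSpace ℝ (Fin N) ↦
    ‖v z.1 - v (z.1 + t • (z.2 - z.1))‖ₑ ^ 2 :=
    (Continuous.enorm (by fun_prop)).measurable.pow_const 2
  have hJ1 : ∀ x ∈ ball x₀ ρ, J x ≤ (volume (ball x₀ ρ))⁻¹ * (ENNReal.ofReal ((t ^ N)⁻¹) * b) := by
    intro x hx
    rw [hJ, hπ]
    simp only [lintegral_smul_measure, smul_eq_mul]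
    gcongr
    exact setLIntegral_ball_comp_contraction_le x₀ ⟨ht0, by linarith [ht.2]⟩ hx mvp
  have hJ2 : ∫⁻ x in ball x₀ ρ, J x ≤ ENNReal.ofReal (2 ^ N) * b := by
    rw [hJ, lintegral_lintegral_swap mJ.aemeasurable]
    calc _ ≤ ∫⁻ y, ENNReal.ofReal (2 ^ N) * b ∂π := by
          refine lintegral_mono_ae ?_
          filter_upwards [hπB] with y hy
          have ht2 : 1 / 2 ≤ 1 - t := by linarith [ht.2]
          calc _ = ∫⁻ x in ball x₀ ρ, ‖v (y + (1 - t) • (x - y))‖ₑ ^ p := by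
                refine lintegral_congr fun x ↦ ?_
                rw [show x + t • (y - x) = y + (1 - t) • (x - y) by module]
            _ ≤ _ := setLIntegral_ball_comp_contraction_le x₀ (c := 1 - t)
                ⟨by linarith, by linarith [ht.1]⟩ hy mvp
            _ ≤ _ := by
                gcongr
                rw [← inv_pow]
                gcongr
                rw [inv_le_comm₀ (by linarith) (by norm_num)]
                linarith
      _ = _ := by simp
  have hpt : ∀ x ∈ ball x₀ ρ, ‖v x‖ₑ ^ 2 ≤ 2 * (∫⁻ y, ‖v x - v (x + t • (y - x))‖ₑ ^ 2 ∂π) +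
      2 * (((volume (ball x₀ ρ))⁻¹ * (ENNReal.ofReal ((t ^ N)⁻¹) * b)) ^ (2 / p - 1) * J x) := by
    intro x hx
    have h1 : ‖v x‖ₑ ≤ (∫⁻ y, ‖v x - v (x + t • (y - x))‖ₑ ∂π) +
        ∫⁻ y, ‖v (x + t • (y - x))‖ₑ ∂π := by
      rw [← lintegral_add_left (Continuous.enorm (by fun_prop)).measurable]
      calc ‖v x‖ₑ = ∫⁻ y, ‖v x‖ₑ ∂π := by simp
        _ ≤ _ := lintegral_mono fun y ↦ by
          simpa using enorm_add_le (v x - v (x + t • (y - x))) (v (x + t • (y - x)))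
    have h2 : (∫⁻ y, ‖v x - v (x + t • (y - x))‖ₑ ∂π) ^ 2 ≤
        ∫⁻ y, ‖v x - v (x + t • (y - x))‖ₑ ^ 2 ∂π := by
      simpa using sq_lintegral_le π (f := fun y ↦ ‖v x - v (x + t • (y - x))‖ₑ) (by fun_prop)
    have h3 : (∫⁻ y, ‖v (x + t • (y - x))‖ₑ ∂π) ^ 2 ≤
        ((volume (ball x₀ ρ))⁻¹ * (ENNReal.ofReal ((t ^ N)⁻¹) * b)) ^ (2 / p - 1) * J x := by
      have h4 := rpow_lintegral_le_lintegral_rpow π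
        (f := fun y ↦ ‖v (x + t • (y - x))‖ₑ) (by fun_prop) hp.1
      have h5 : 0 ≤ 2 / p - 1 := by
        rw [sub_nonneg, one_le_div hp0]
        exact hp.2
      calc _ = ((∫⁻ y, ‖v (x + t • (y - x))‖ₑ ∂π) ^ p) ^ (2 / p) := by
            rw [← ENNReal.rpow_mul, mul_div_cancel₀ _ hp0.ne', ENNReal.rpow_ofNat]
        _ ≤ J x ^ (2 / p) := by gcongr
        -- The first factor takes the pointwise bound on J; the second is kept for integration in x.
        _ = J x ^ (2 / p - 1) * J x := by
            conv_rhs => rw [← ENNReal.rpow_one (J x), ← ENNReal.rpow_mul, mul_comm,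
              ← ENNReal.rpow_add_of_nonneg _ _ (by norm_num) (by simpa using h5)]
            ring_nf
        _ ≤ _ := by
            gcongr
            exact hJ1 x hx
    calc ‖v x‖ₑ ^ 2 ≤ _ := pow_le_pow_left' h1 2
      _ ≤ 2 * (_ + _) := by
          simpa [show (2 : ℝ) - 1 = 1 by norm_num] using
            ENNReal.rpow_add_le_mul_rpow_add_rpow _ _ (p := 2) (by norm_num)
      _ ≤ _ := by
          rw [mul_add]
          gcongr
  calc _ ≤ _ := setLIntegral_mono' measurableSet_ball hpt
    _ = 2 * (∫⁻ x in ball x₀ ρ, ∫⁻ y, ‖v x - v (x + t • (y - x))‖ₑ ^ 2 ∂π) +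
      2 * (((volume (ball x₀ ρ))⁻¹ * (ENNReal.ofReal ((t ^ N)⁻¹) * b)) ^ (2 / p - 1) *
        ∫⁻ x in ball x₀ ρ, J x) := by
        rw [lintegral_add_left (mD.lintegral_prod_right'.const_mul 2),
          lintegral_const_mul _ mD.lintegral_prod_right',
          lintegral_const_mul _ (mJ.lintegral_prod_right'.const_mul _),
          lintegral_const_mul _ mJ.lintegral_prod_right']
    _ ≤ _ := by
        gcongr
        rw [lintegral_lintegral_swap mD.aemeasurable]
        calc _ ≤ ∫⁻ y, ENNReal.ofReal (2 ^ (N + 2) * (ρ * t) ^ 2) * E ∂π := by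
              refine lintegral_mono_ae ?_
              filter_upwards [hπB] with y hy
              exact lintegral_ball_sub_contraction_le x₀ ht hv hy
          _ = _ := by simp

end Nash

/-! ### The exponents, and the interpolation-trace inequality for C¹ functions. -/

section TraceInterpolation

variable {N : ℕ}

theorem kExp_pos (N : ℕ) {m : ℝ} (hm : m ∈ Ioo (0 : ℝ) 1) : 0 < kExp N m := by
  have := hm.1
  have : 0 ≤ 1 - m := by linarith [hm.2]
  unfold kExp
  positivity

theorem nuExp_eq (N : ℕ) {m : ℝ} (hm : m ∈ Ioo (0 : ℝ) 1) :
    nuExp N m = 2 + N * (2 / (m + 1) - 1) := by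
  have := hm.1
  unfold nuExp kExp
  field_simp
  ring

theorem two_lt_nuExp (hN : 0 < N) {m : ℝ} (hm : m ∈ Ioo (0 : ℝ) 1) : 2 < nuExp N m := by
  have h1 : 0 < 2 / (m + 1) - 1 := by
    rw [sub_pos, one_lt_div (by linarith [hm.1])]
    linarith [hm.2]
  rw [nuExp_eq N hm]
  have : (0 : ℝ) < N := by exact_mod_cast hN
  nlinarith

theorem nuExp_le (N : ℕ) {m : ℝ} (hm : m ∈ Ioo (0 : ℝ) 1) : nuExp N m ≤ N + 2 := by
  have h1 : 2 / (m + 1) - 1 ≤ 1 := by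
    rw [sub_le_iff_le_add, div_le_iff₀ (by linarith [hm.1])]
    linarith [hm.1]
  rw [nuExp_eq N hm]
  have : (0 : ℝ) ≤ N := by positivity
  nlinarith

/-- Optimisation over the scale, isolated as a statement about real numbers: A, T, E stand for the
squared L² norms of v on the ball, v on the sphere and ∇v on the ball, and Q for b^(2/(m+1)). The
lower-order term n A is absorbed because the chosen scale is at most ρ. -/
theorem trace_le_of_scale_family {ν c A T E Q ρ n : ℝ} (hν : 2 < ν) (hc : 1 ≤ c) (hn : 0 ≤ n)
    (hE : 0 ≤ E) (hQ : 0 ≤ Q) (hρ : 0 < ρ)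
    (hA : ∀ t ∈ Ioc (0 : ℝ) (1 / 2), A ≤ c * ((ρ * t) ^ 2 * E + (ρ * t) ^ (2 - ν) * Q))
    (hT : ρ * T ≤ n * A + 2 * ρ * √(A * E)) :
    T ≤ c * 2 ^ ν * (n + 2) * (Q ^ (1 / ν) * (E + ρ ^ (-ν) * Q) ^ (1 - 1 / ν)) := by
  have hν0 : 0 < ν := by linarith
  -- With Q = 0 no scale is optimal; letting t → 0 gives A ≤ 0.
  rcases hQ.eq_or_lt with rfl | hQ
  · have h0 : A ≤ c * ((ρ * 0) ^ 2 * E) := by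
      have hl : Filter.Tendsto (fun t : ℝ ↦ c * ((ρ * t) ^ 2 * E)) (nhdsWithin 0 (Ioi 0))
          (nhds (c * ((ρ * 0) ^ 2 * E))) := by
        refine Filter.Tendsto.mono_left (Continuous.tendsto ?_ 0) nhdsWithin_le_nhds
        fun_prop
      refine ge_of_tendsto hl ?_
      filter_upwards [Ioc_mem_nhdsGT (show (0 : ℝ) < 1 / 2 by norm_num)] with t ht
      simpa using hA t ht
    have hA0 : A ≤ 0 := by simpa using h0
    have h1 : √(A * E) = 0 := Real.sqrt_eq_zero_of_nonpos (mul_nonpos_of_nonpos_of_nonneg hA0 hE)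
    have h2 : ρ * T ≤ 0 := by
      rw [h1] at hT
      nlinarith
    have h3 : T ≤ 0 := nonpos_of_mul_nonpos_right h2 hρ
    refine h3.trans ?_
    positivity
  set q := ρ ^ (-ν) * Q with hq
  have hq0 : 0 < q := by positivity
  set S := E + q with hS
  have hS0 : 0 < S := by positivity
  -- Up to constants, t = w/2 balances the two terms: w^ν S = q turns the Q-term into a multiple of
  -- ρ² w² S, which also bounds the E-term. Using S = E + q rather than E ensures w ≤ 1, so the
  -- scale is admissible.
  set w := (q / S) ^ (1 / ν) with hw
  have hw0 : 0 < w := by positivity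
  have hw1 : w ≤ 1 := Real.rpow_le_one (by positivity)
    ((div_le_one hS0).2 (by linarith)) (by positivity)
  have hwν : w ^ ν * S = q := by
    rw [hw, ← Real.rpow_mul (by positivity), one_div_mul_cancel hν0.ne', Real.rpow_one]
    field_simp
  have h2ν : (1 : ℝ) ≤ 2 ^ (ν - 2) := Real.one_le_rpow (by norm_num) (by linarith)
  have hQq : Q = ρ ^ ν * q := by
    rw [hq, ← mul_assoc, ← Real.rpow_add hρ, add_neg_cancel, Real.rpow_zero, one_mul]
  have h1 : (ρ * (w / 2)) ^ (2 - ν) * Q = 2 ^ (ν - 2) * (ρ ^ 2 * w ^ 2 * S) := by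
    rw [hQq, ← hwν, Real.mul_rpow hρ.le (by positivity), Real.div_rpow hw0.le (by norm_num),
      show ν - 2 = -(2 - ν) by ring, Real.rpow_neg (by norm_num)]
    have e1 : ρ ^ (2 - ν) * ρ ^ ν = ρ ^ 2 := by
      rw [← Real.rpow_add hρ, sub_add_cancel, Real.rpow_ofNat]
    have e2 : w ^ (2 - ν) * w ^ ν = w ^ 2 := by
      rw [← Real.rpow_add hw0, sub_add_cancel, Real.rpow_ofNat]
    rw [← e1, ← e2]
    field_simp
  have hA1 : A ≤ c * 2 ^ ν * (ρ ^ 2 * w ^ 2 * S) := by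
    refine (hA (w / 2) ⟨by positivity, by linarith⟩).trans ?_
    rw [h1, mul_assoc c]
    have e : (2 : ℝ) ^ ν = 4 * 2 ^ (ν - 2) := by
      rw [Real.rpow_sub (by norm_num), Real.rpow_ofNat]
      ring
    have h3 : (ρ * (w / 2)) ^ 2 * E ≤ 1 * (ρ ^ 2 * w ^ 2 * S) := by
      have : E ≤ S := by linarith
      calc _ = (1 / 4) * (ρ ^ 2 * w ^ 2 * E) := by ring
        _ ≤ _ := by gcongr; norm_num
    have h4 : 0 ≤ ρ ^ 2 * w ^ 2 * S := by positivity
    refine mul_le_mul_of_nonneg_left ?_ (by linarith)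
    rw [e]
    nlinarith
  set c' := c * 2 ^ ν with hc'
  have hc1 : 1 ≤ c' := by
    rw [hc']
    have : (1 : ℝ) ≤ 2 ^ ν := Real.one_le_rpow (by norm_num) (by linarith)
    nlinarith
  have hsq : √(A * E) ≤ c' * (ρ * w * S) := by
    refine Real.sqrt_le_iff.2 ⟨by positivity, ?_⟩
    have hES : E ≤ S := by linarith
    calc A * E ≤ c' * (ρ ^ 2 * w ^ 2 * S) * S := by gcongr
      _ = c' * 1 * (ρ * w * S) ^ 2 := by ring
      _ ≤ c' * c' * (ρ * w * S) ^ 2 := by gcongr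
      _ = _ := by ring
  have hT1 : ρ * T ≤ ρ * (ρ * (c' * (n + 2) * (w * S))) := by
    calc ρ * T ≤ n * (c' * (ρ ^ 2 * w ^ 2 * S)) + 2 * ρ * (c' * (ρ * w * S)) := by
          refine hT.trans ?_
          gcongr
      _ = c' * ρ ^ 2 * S * w * (n * w + 2) := by ring
      _ ≤ c' * ρ ^ 2 * S * w * (n * 1 + 2) := by gcongr
      _ = _ := by ring
  refine (le_of_mul_le_mul_left hT1 hρ).trans_eq ?_
  have hw2 : w = ρ⁻¹ * Q ^ (1 / ν) * S ^ (-(1 / ν)) := by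
    rw [hw, Real.div_rpow hq0.le hS0.le, hq, Real.mul_rpow (by positivity) hQ.le,
      ← Real.rpow_mul hρ.le, show -ν * (1 / ν) = -1 by field_simp, Real.rpow_neg_one,
      Real.rpow_neg hS0.le]
    rfl
  rw [hw2, sub_eq_neg_add, Real.rpow_add hS0, Real.rpow_one]
  field_simp

/-- The constant of the interpolation-trace inequality on balls of `ℝ^N`. -/
noncomputable def traceConst (N : ℕ) : ℝ :=
  2 ^ (N + 3) * max 1 (volume.real (ball (0 : EuclideanSpace ℝ (Fin N)) 1))⁻¹ * 2 ^ (N + 2) * (N + 2)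

theorem traceConst_pos (N : ℕ) : 0 < traceConst N := by
  unfold traceConst
  positivity

/-- Since 0 ≤ s ≤ 1, the factor V^(-s) is at most max(1, 1/V), a bound free of s and hence of m. -/
theorem inv_mul_rpow_mul_le {V r b s q : ℝ} (hV : 0 < V) (hr : 0 < r) (hb : 0 ≤ b)
    (hs : s ∈ Icc (0 : ℝ) 1) (hq : s + 1 = q) :
    (V⁻¹ * r⁻¹ * b) ^ s * b ≤ max 1 V⁻¹ * (r ^ (-s) * b ^ q) := by
  have h1 : V⁻¹ ^ s ≤ max 1 V⁻¹ := by
    calc V⁻¹ ^ s ≤ (max 1 V⁻¹) ^ s := Real.rpow_le_rpow (by positivity) (le_max_right _ _) hs.1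
      _ ≤ (max 1 V⁻¹) ^ (1 : ℝ) := Real.rpow_le_rpow_of_exponent_le (le_max_left _ _) hs.2
      _ = _ := Real.rpow_one _
  rw [Real.mul_rpow (by positivity) hb, Real.mul_rpow (by positivity) (by positivity),
    Real.inv_rpow hr.le, ← Real.rpow_neg hr.le, ← hq,
    Real.rpow_add_of_nonneg hb hs.1 zero_le_one, Real.rpow_one]
  calc _ = V⁻¹ ^ s * (r ^ (-s) * (b ^ s * b)) := by ring
    _ ≤ _ := by gcongr

/-- Interpolation-trace inequality on a ball, for `C¹` functions. -/
theorem lintegral_surfaceMeasure_le_of_contDiff (hN : 0 < N) {m : ℝ} (hm : m ∈ Ioo (0 : ℝ) 1)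
    (x₀ : EuclideanSpace ℝ (Fin N)) {ρ : ℝ} (hρ : 0 < ρ)
    {v : EuclideanSpace ℝ (Fin N) → ℂ} (hv : ContDiff ℝ 1 v)
    (hE : ∫⁻ x in ball x₀ ρ, ‖fderiv ℝ v x‖ₑ ^ 2 ≠ ⊤)
    (hb : ∫⁻ x in ball x₀ ρ, ‖v x‖ₑ ^ (m + 1) ≠ ⊤) :
    ∫⁻ x, ‖v x‖ₑ ^ 2 ∂(surfaceMeasure x₀ ρ) ≤ ENNReal.ofReal (traceConst N) *
      ((∫⁻ x in ball x₀ ρ, ‖v x‖ₑ ^ (m + 1)) ^ (2 / kExp N m) *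
        ((∫⁻ x in ball x₀ ρ, ‖fderiv ℝ v x‖ₑ ^ 2) + ENNReal.ofReal (ρ ^ (-nuExp N m)) *
          (∫⁻ x in ball x₀ ρ, ‖v x‖ₑ ^ (m + 1)) ^ (2 / (m + 1))) ^ (1 - 1 / nuExp N m)) := by
  have hp : 0 < m + 1 := by linarith [hm.1]
  have hs : 2 / (m + 1) - 1 ∈ Icc (0 : ℝ) 1 := by
    constructor
    · rw [sub_nonneg, one_le_div hp]
      linarith [hm.2]
    · rw [sub_le_iff_le_add, div_le_iff₀ hp]
      linarith [hm.1]
  have hν := two_lt_nuExp hN hm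
  have hk := kExp_pos N hm
  have hc' : Continuous (fderiv ℝ v) := hv.continuous_fderiv one_ne_zero
  have nash := fun t ht ↦ lintegral_ball_enorm_sq_le x₀ (p := m + 1) (t := t) hρ ht
    ⟨by linarith [hm.1], by linarith [hm.2]⟩ hv
  have trace := lintegral_surfaceMeasure_enorm_sq_le hN x₀ hρ hv
  have cs := sq_lintegral_mul_le (volume.restrict (ball x₀ ρ)) (f := fun x ↦ ‖v x‖ₑ)
    (g := fun x ↦ ‖fderiv ℝ v x‖ₑ) hv.continuous.enorm.measurable.aemeasurable
    hc'.enorm.measurable.aemeasurable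
  generalize ∫⁻ x in ball x₀ ρ, ‖v x‖ₑ ^ 2 = A at *
  generalize ∫⁻ x, ‖v x‖ₑ ^ 2 ∂(surfaceMeasure x₀ ρ) = T at *
  generalize ∫⁻ x in ball x₀ ρ, ‖v x‖ₑ * ‖fderiv ℝ v x‖ₑ = X at *
  lift (∫⁻ x in ball x₀ ρ, ‖fderiv ℝ v x‖ₑ ^ 2) to NNReal using hE with E
  lift (∫⁻ x in ball x₀ ρ, ‖v x‖ₑ ^ (m + 1)) to NNReal using hb with b
  have hV : volume (ball x₀ ρ) = ENNReal.ofReal (ρ ^ N *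
      volume.real (ball (0 : EuclideanSpace ℝ (Fin N)) 1)) := by
    rw [Measure.addHaar_ball_of_pos _ _ hρ, finrank_euclideanSpace_fin,
      ENNReal.ofReal_mul (by positivity), ofReal_measureReal measure_ball_lt_top.ne]
  have hV0 : 0 < volume.real (ball (0 : EuclideanSpace ℝ (Fin N)) 1) :=
    ENNReal.toReal_pos (measure_ball_pos _ _ one_pos).ne' measure_ball_lt_top.ne
  set V := volume.real (ball (0 : EuclideanSpace ℝ (Fin N)) 1) with hVdef
  set c := 2 ^ (N + 3) * max 1 V⁻¹ with hc
  have hc1 : 1 ≤ c := by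
    rw [hc]
    exact one_le_mul_of_one_le_of_one_le (one_le_pow₀ (by norm_num)) (le_max_left _ _)
  have hNash : ∀ t ∈ Ioc (0 : ℝ) (1 / 2), A ≤ ENNReal.ofReal
      (c * ((ρ * t) ^ 2 * E + (ρ * t) ^ (2 - nuExp N m) * (b : ℝ) ^ (2 / (m + 1)))) := by
    intro t ht
    have ht0 := ht.1
    refine (nash t ht).trans ?_
    rw [hV, ← ENNReal.ofReal_inv_of_pos (by positivity), ← ENNReal.ofReal_coe_nnreal (p := E),
      ← ENNReal.ofReal_coe_nnreal (p := b), ← ENNReal.ofReal_mul (by positivity),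
      ← ENNReal.ofReal_mul (by positivity), ← ENNReal.ofReal_mul (by positivity),
      ENNReal.ofReal_rpow_of_nonneg (by positivity) hs.1, ← ENNReal.ofReal_mul (by positivity),
      ← ENNReal.ofReal_mul (by positivity), show (2 : ℝ≥0∞) = ENNReal.ofReal 2 by simp,
      ← ENNReal.ofReal_mul (by positivity), ← ENNReal.ofReal_mul (by positivity),
      ← ENNReal.ofReal_add (by positivity) (by positivity)]
    refine ENNReal.ofReal_le_ofReal ?_
    have h1 := inv_mul_rpow_mul_le hV0 (r := (ρ * t) ^ N) (by positivity) b.2 hs (sub_add_cancel _ _)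
    -- This is where ν enters: N(2/(m+1) - 1) = ν - 2.
    have e1 : ((ρ * t) ^ N) ^ (-(2 / (m + 1) - 1)) = (ρ * t) ^ (2 - nuExp N m) := by
      rw [← Real.rpow_natCast, ← Real.rpow_mul (by positivity), nuExp_eq N hm]
      ring_nf
    have e2 : (ρ ^ N * V)⁻¹ * ((t ^ N)⁻¹ * b) = V⁻¹ * ((ρ * t) ^ N)⁻¹ * b := by
      rw [mul_pow]
      field_simp
    rw [e1] at h1
    rw [e2]
    have h2 : 2 ^ (N + 1) ≤ (2 : ℝ) ^ (N + 3) := pow_le_pow_right₀ (by norm_num) (by lia)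
    calc _ = 2 ^ (N + 3) * 1 * ((ρ * t) ^ 2 * E) +
          2 ^ (N + 1) * ((V⁻¹ * ((ρ * t) ^ N)⁻¹ * b) ^ (2 / (m + 1) - 1) * b) := by ring
      _ ≤ 2 ^ (N + 3) * max 1 V⁻¹ * ((ρ * t) ^ 2 * E) + 2 ^ (N + 3) *
          (max 1 V⁻¹ * ((ρ * t) ^ (2 - nuExp N m) * (b : ℝ) ^ (2 / (m + 1)))) := by
        refine add_le_add ?_ (mul_le_mul h2 h1 (by positivity) (by positivity))
        gcongr
        exact le_max_left _ _
      _ = _ := by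
        rw [hc]
        ring
  -- Square integrability of v on the ball is not assumed; Nash's inequality at one scale provides
  -- it.
  have hAtop : A ≠ ⊤ := ne_top_of_le_ne_top ENNReal.ofReal_ne_top (hNash (1 / 2) (by norm_num))
  lift A to NNReal using hAtop
  have hX : X ≤ ENNReal.ofReal √(A * E) := by
    rw [← ENNReal.ofReal_coe_nnreal (p := A), ← ENNReal.ofReal_coe_nnreal (p := E),
      ← ENNReal.ofReal_mul (by positivity), ← Real.sq_sqrt (show (0 : ℝ) ≤ A * E by positivity),
      ENNReal.ofReal_pow (by positivity)] at cs
    exact (ENNReal.pow_le_pow_left_iff two_ne_zero).1 cs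
  have hT1 : ENNReal.ofReal ρ * T ≤ ENNReal.ofReal (N * A + 2 * ρ * √(A * E)) := by
    refine trace.trans ?_
    rw [ENNReal.ofReal_add (by positivity) (by positivity), ENNReal.ofReal_mul (by positivity),
      ENNReal.ofReal_mul (by positivity), ENNReal.ofReal_mul (by positivity)]
    simp only [ENNReal.ofReal_natCast, ENNReal.ofReal_coe_nnreal, ENNReal.ofReal_ofNat]
    gcongr
  have hTtop : T ≠ ⊤ := by
    intro h
    rw [h, ENNReal.mul_top (by simpa using hρ)] at hT1
    simp at hT1
  lift T to NNReal using hTtop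
  have key := trace_le_of_scale_family (T := T) (A := A) (E := E) (Q := (b : ℝ) ^ (2 / (m + 1)))
    (n := N) hν hc1 (by positivity) E.2 (by positivity) hρ
    (fun t ht ↦ by
      have ht0 := ht.1
      have := hNash t ht
      rw [← ENNReal.ofReal_coe_nnreal (p := A)] at this
      exact (ENNReal.ofReal_le_ofReal_iff (by positivity)).1 this)
    (by
      rw [← ENNReal.ofReal_coe_nnreal (p := T), ← ENNReal.ofReal_mul hρ.le] at hT1
      exact (ENNReal.ofReal_le_ofReal_iff (by positivity)).1 hT1)
  have hθ : 0 ≤ 1 - 1 / nuExp N m := by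
    rw [sub_nonneg, div_le_one (by linarith)]
    linarith
  rw [← ENNReal.ofReal_coe_nnreal (p := T), ← ENNReal.ofReal_coe_nnreal (p := E),
    ← ENNReal.ofReal_coe_nnreal (p := b), ENNReal.ofReal_rpow_of_nonneg b.coe_nonneg (by positivity),
    ENNReal.ofReal_rpow_of_nonneg b.coe_nonneg (by positivity), ← ENNReal.ofReal_mul (by positivity),
    ← ENNReal.ofReal_add (by positivity) (by positivity),
    ENNReal.ofReal_rpow_of_nonneg (by positivity) hθ, ← ENNReal.ofReal_mul (by positivity),
    ← ENNReal.ofReal_mul (traceConst_pos N).le]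
  refine ENNReal.ofReal_le_ofReal (key.trans ?_)
  have e3 : ((b : ℝ) ^ (2 / (m + 1))) ^ (1 / nuExp N m) = (b : ℝ) ^ (2 / kExp N m) := by
    rw [← Real.rpow_mul b.coe_nonneg]
    congr 1
    unfold nuExp
    field_simp
  rw [e3]
  gcongr
  -- The bound ν ≤ N + 2 removes the last dependence of the constant on m.
  rw [traceConst, ← hVdef, ← hc]
  gcongr
  rw [← Real.rpow_natCast]
  exact Real.rpow_le_rpow_of_exponent_le (by norm_num) (by simpa using nuExp_le N hm)

end TraceInterpolation

/-! ### Mollification and weak gradients. -/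

section Mollification

variable {N : ℕ}

theorem norm_sum_mul_ofReal_le (g : EuclideanSpace ℂ (Fin N)) (h : EuclideanSpace ℝ (Fin N)) :
    ‖∑ i, g i * (h i : ℂ)‖ ≤ ‖g‖ * ‖h‖ := by
  calc _ ≤ ∑ i, ‖g i‖ * ‖h i‖ := by
        refine (norm_sum_le _ _).trans_eq (Finset.sum_congr rfl fun i _ ↦ ?_)
        rw [norm_mul, Complex.norm_real]
    _ ≤ _ := by
        rw [EuclideanSpace.norm_eq, EuclideanSpace.norm_eq]
        exact Real.sum_mul_le_sqrt_mul_sqrt _ _ _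

/-- Jensen's inequality for the probability measure with density η, then Tonelli: a translation by
less than ε keeps B(x₀,r) inside B(x₀,r+ε). -/
theorem lintegral_ball_convolution_rpow_le (x₀ : EuclideanSpace ℝ (Fin N)) {r ε q : ℝ}
    (hq : 1 ≤ q) {η g : EuclideanSpace ℝ (Fin N) → ℝ≥0∞} (hη : Measurable η) (hg : Measurable g)
    (hη1 : ∫⁻ y, η y = 1) (hsupp : ∀ y, y ∉ ball 0 ε → η y = 0) :
    ∫⁻ x in ball x₀ r, (∫⁻ y, η y * g (x - y)) ^ q ≤ ∫⁻ x in ball x₀ (r + ε), g x ^ q := by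
  set π : Measure (EuclideanSpace ℝ (Fin N)) := volume.withDensity η
  have : IsProbabilityMeasure π := ⟨by simp [π, hη1]⟩
  have hπ (f : EuclideanSpace ℝ (Fin N) → ℝ≥0∞) (hf : Measurable f) :
      ∫⁻ y, f y ∂π = ∫⁻ y, η y * f y := lintegral_withDensity_eq_lintegral_mul _ hη hf
  have hπε : ∀ᵐ y ∂π, y ∈ ball (0 : EuclideanSpace ℝ (Fin N)) ε := by
    rw [ae_withDensity_iff hη]
    exact ae_of_all _ fun y hy ↦ by
      contrapose! hy
      exact hsupp y hy
  have hgm (x : EuclideanSpace ℝ (Fin N)) : Measurable fun y ↦ g (x - y) := by fun_prop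
  calc _ = ∫⁻ x in ball x₀ r, (∫⁻ y, g (x - y) ∂π) ^ q := by
        simp_rw [fun x ↦ hπ _ (hgm x)]
    _ ≤ ∫⁻ x in ball x₀ r, ∫⁻ y, g (x - y) ^ q ∂π :=
        lintegral_mono fun x ↦ rpow_lintegral_le_lintegral_rpow π (hgm x).aemeasurable hq
    _ = ∫⁻ y, (∫⁻ x in ball x₀ r, g (x - y) ^ q) ∂π := by
        rw [lintegral_lintegral_swap]
        fun_prop
    _ ≤ ∫⁻ y, (∫⁻ x in ball x₀ (r + ε), g x ^ q) ∂π := by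
        refine lintegral_mono_ae ?_
        filter_upwards [hπε] with y hy
        rw [← lintegral_indicator measurableSet_ball, ← lintegral_indicator measurableSet_ball]
        calc _ ≤ ∫⁻ x, (ball x₀ (r + ε)).indicator (fun x ↦ g x ^ q) (x - y) := by
              refine lintegral_mono fun x ↦ ?_
              by_cases hx : x ∈ ball x₀ r
              · have : x - y ∈ ball x₀ (r + ε) := by
                  rw [mem_ball] at hx ⊢
                  rw [mem_ball_zero_iff] at hy
                  calc dist (x - y) x₀ ≤ dist (x - y) x + dist x x₀ := dist_triangle _ _ _
                    _ < _ := by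
                      rw [dist_eq_norm (x - y), sub_sub_cancel_left, norm_neg]
                      linarith
                rw [indicator_of_mem hx, indicator_of_mem this]
              · rw [indicator_of_notMem hx]
                exact zero_le
          _ = _ := lintegral_sub_right_eq_self _ y
    _ = _ := by simp

theorem fderiv_convolution_apply {η : EuclideanSpace ℝ (Fin N) → ℝ} (hη : ContDiff ℝ ∞ η)
    (hηc : HasCompactSupport η) {u : EuclideanSpace ℝ (Fin N) → ℂ} (hu : LocallyIntegrable u)
    (x h : EuclideanSpace ℝ (Fin N)) :
    fderiv ℝ (convolution η u (ContinuousLinearMap.lsmul ℝ ℝ) volume) x h =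
      ∫ t, u t * (fderiv ℝ η (x - t) h : ℂ) := by
  have h1 := hηc.hasFDerivAt_convolution_right (ContinuousLinearMap.lsmul ℝ ℝ).flip hu
    (hη.of_le (by norm_num)) x
  rw [convolution_flip] at h1
  rw [h1.fderiv, convolution_precompR_apply _ hu (hηc.fderiv ℝ)
    (hη.continuous_fderiv (by simp)), convolution_def]
  refine integral_congr_ae (ae_of_all _ fun t ↦ ?_)
  simp [mul_comm]

/-- The derivative falls on the kernel, and t ↦ η(x-t) is an admissible test function when the
closed ball of radius r about x lies in Ω. Thus the derivative of the mollification is the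
mollification of G, and `norm_sum_mul_ofReal_le` bounds its operator norm. -/
theorem enorm_fderiv_convolution_le {η : EuclideanSpace ℝ (Fin N) → ℝ} (hη : ContDiff ℝ ∞ η)
    (hη0 : ∀ y, 0 ≤ η y) {r : ℝ} (hηr : Function.support η ⊆ closedBall 0 r)
    {Ω : Set (EuclideanSpace ℝ (Fin N))}
    {u : EuclideanSpace ℝ (Fin N) → ℂ} {G : EuclideanSpace ℝ (Fin N) → EuclideanSpace ℂ (Fin N)}
    (hu : LocallyIntegrable u) (hG : LocallyIntegrable G)
    (hw : ∀ φ : EuclideanSpace ℝ (Fin N) → ℝ,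
      ContDiff ℝ ∞ φ → HasCompactSupport φ → tsupport φ ⊆ Ω → ∀ i : Fin N,
        ∫ x, u x * (fderiv ℝ φ x (EuclideanSpace.single i 1) : ℂ) = -∫ x, G x i * (φ x : ℂ))
    {x : EuclideanSpace ℝ (Fin N)} (hx : closedBall x r ⊆ Ω) :
    ‖fderiv ℝ (convolution η u (ContinuousLinearMap.lsmul ℝ ℝ) volume) x‖ₑ ≤
      ∫⁻ y, ENNReal.ofReal (η y) * ‖G (x - y)‖ₑ := by
  have hηc : HasCompactSupport η :=
    HasCompactSupport.of_support_subset_isCompact (isCompact_closedBall 0 r) hηr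
  set ψ : EuclideanSpace ℝ (Fin N) → ℝ := fun t ↦ η (x - t) with hψ
  have hψ1 : ContDiff ℝ ∞ ψ := by fun_prop
  have hψs : Function.support ψ ⊆ closedBall x r := by
    intro t ht
    have := hηr ht
    rwa [mem_closedBall_zero_iff, ← dist_eq_norm, dist_comm] at this
  have hψc : HasCompactSupport ψ :=
    HasCompactSupport.of_support_subset_isCompact (isCompact_closedBall x r) hψs
  have hψt : tsupport ψ ⊆ Ω := (closure_minimal hψs isClosed_closedBall).trans hx
  have hψd (t h : EuclideanSpace ℝ (Fin N)) : fderiv ℝ ψ t h = -fderiv ℝ η (x - t) h := by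
    have h1 : HasFDerivAt ψ _ t := ((hη.differentiable (by simp) (x - t)).hasFDerivAt).comp t
      ((hasFDerivAt_id t).const_sub x)
    rw [h1.fderiv]
    simp
  have hint (i : Fin N) : Integrable fun t ↦ G t i * (ψ t : ℂ) := by
    have h1 := hG.integrable_smul_left_of_hasCompactSupport hψ1.continuous hψc
    refine ((EuclideanSpace.proj i : EuclideanSpace ℂ (Fin N) →L[ℂ] ℂ).integrable_comp h1).congr
      (ae_of_all _ fun t ↦ ?_)
    simp [mul_comm]
  set D := fderiv ℝ (convolution η u (ContinuousLinearMap.lsmul ℝ ℝ) volume) x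
  have hD (i : Fin N) : D (EuclideanSpace.single i 1) = ∫ t, G t i * (ψ t : ℂ) := by
    rw [fderiv_convolution_apply hη hηc hu, ← neg_neg (∫ t, G t i * (ψ t : ℂ)),
      ← hw ψ hψ1 hψc hψt i, ← integral_neg]
    refine integral_congr_ae (ae_of_all _ fun t ↦ ?_)
    simp [hψd]
  have hDh (h : EuclideanSpace ℝ (Fin N)) :
      D h = ∫ t, (∑ i, G t i * (h i : ℂ)) * (ψ t : ℂ) := by
    have hh : h = ∑ i, h i • EuclideanSpace.single i (1 : ℝ) := by
      simpa using ((EuclideanSpace.basisFun (Fin N) ℝ).sum_repr h).symm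
    conv_lhs => rw [hh, map_sum]
    simp_rw [map_smul, hD, Finset.sum_mul]
    rw [integral_finsetSum]
    · refine Finset.sum_congr rfl fun i _ ↦ ?_
      rw [Complex.real_smul, ← integral_const_mul]
      refine integral_congr_ae (ae_of_all _ fun t ↦ ?_)
      ring
    · intro i _
      refine ((hint i).const_mul (h i : ℂ)).congr (ae_of_all _ fun t ↦ ?_)
      ring
  have hswap : ∫⁻ y, ENNReal.ofReal (η y) * ‖G (x - y)‖ₑ =
      ∫⁻ t, ENNReal.ofReal (ψ t) * ‖G t‖ₑ := by
    rw [← lintegral_sub_left_eq_self (fun t ↦ ENNReal.ofReal (ψ t) * ‖G t‖ₑ) x]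
    simp [hψ]
  rw [hswap]
  refine D.opENorm_le_bound fun h ↦ ?_
  rw [hDh]
  refine (enorm_integral_le_lintegral_enorm _).trans ?_
  have hm : AEMeasurable (fun t ↦ ENNReal.ofReal (ψ t) * ‖G t‖ₑ) :=
    (hψ1.continuous.measurable.ennreal_ofReal.aemeasurable).mul
      hG.aestronglyMeasurable.enorm
  rw [← lintegral_mul_const'' _ hm]
  refine lintegral_mono fun t ↦ ?_
  rw [← ofReal_norm, ← ofReal_norm, ← ofReal_norm, ← ENNReal.ofReal_mul (hη0 _),
    ← ENNReal.ofReal_mul (mul_nonneg (hη0 _) (norm_nonneg _))]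
  refine ENNReal.ofReal_le_ofReal ?_
  rw [norm_mul, Complex.norm_real, Real.norm_of_nonneg (hη0 _), mul_comm, mul_assoc]
  exact mul_le_mul_of_nonneg_left (norm_sum_mul_ofReal_le _ _) (hη0 _)

end Mollification

/-! ### Passage to the limit in the trace inequality. -/

section SobolevTrace

variable {N : ℕ}

/-- The right-hand side of the interpolation-trace inequality on a ball of radius `ρ`, in terms of
`E = ‖∇u‖²` and `b = ‖u‖_{m+1}^{m+1}`. -/
noncomputable def traceBound (N : ℕ) (m ρ : ℝ) (E b : ℝ≥0∞) : ℝ≥0∞ :=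
  ENNReal.ofReal (traceConst N) * (b ^ (2 / kExp N m) *
    (E + ENNReal.ofReal (ρ ^ (-nuExp N m)) * b ^ (2 / (m + 1))) ^ (1 - 1 / nuExp N m))

theorem one_sub_inv_nuExp_pos (hN : 0 < N) {m : ℝ} (hm : m ∈ Ioo (0 : ℝ) 1) :
    0 < 1 - 1 / nuExp N m := by
  have := two_lt_nuExp hN hm
  rw [sub_pos, div_lt_one (by linarith)]
  linarith

theorem traceBound_mono (hN : 0 < N) {m : ℝ} (hm : m ∈ Ioo (0 : ℝ) 1) (ρ : ℝ)
    {E E' b b' : ℝ≥0∞} (hE : E ≤ E') (hb : b ≤ b') :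
    traceBound N m ρ E b ≤ traceBound N m ρ E' b' := by
  have h1 := one_sub_inv_nuExp_pos hN hm
  have h2 := kExp_pos N hm
  have h3 := hm.1
  unfold traceBound
  gcongr

theorem tendsto_traceBound (hN : 0 < N) {m : ℝ} (hm : m ∈ Ioo (0 : ℝ) 1) (ρ : ℝ)
    {ι : Type*} {l : Filter ι} {E b : ι → ℝ≥0∞} {E' b' : ℝ≥0∞} (hE' : E' ≠ ⊤) (hb' : b' ≠ ⊤)
    (hE : Filter.Tendsto E l (nhds E')) (hb : Filter.Tendsto b l (nhds b')) :
    Filter.Tendsto (fun i ↦ traceBound N m ρ (E i) (b i)) l (nhds (traceBound N m ρ E' b')) := by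
  have h1 := one_sub_inv_nuExp_pos hN hm
  have h2 := kExp_pos N hm
  have h3 := hm.1
  have f1 : b' ^ (2 / kExp N m) ≠ ⊤ := ENNReal.rpow_ne_top_of_nonneg (by positivity) hb'
  have f2 : b' ^ (2 / (m + 1)) ≠ ⊤ := ENNReal.rpow_ne_top_of_nonneg (by positivity) hb'
  have f3 : E' + ENNReal.ofReal (ρ ^ (-nuExp N m)) * b' ^ (2 / (m + 1)) ≠ ⊤ :=
    ENNReal.add_ne_top.2 ⟨hE', ENNReal.mul_ne_top ENNReal.ofReal_ne_top f2⟩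
  refine ENNReal.Tendsto.const_mul ?_ (Or.inr ENNReal.ofReal_ne_top)
  refine ENNReal.Tendsto.mul ((ENNReal.continuous_rpow_const.tendsto _).comp hb)
    (Or.inr (ENNReal.rpow_ne_top_of_nonneg h1.le f3)) ?_ (Or.inr f1)
  refine (ENNReal.continuous_rpow_const.tendsto _).comp (hE.add ?_)
  exact ENNReal.Tendsto.const_mul ((ENNReal.continuous_rpow_const.tendsto _).comp hb)
    (Or.inr ENNReal.ofReal_ne_top)

theorem monotone_setLIntegral_ball (x₀ : EuclideanSpace ℝ (Fin N))
    (f : EuclideanSpace ℝ (Fin N) → ℝ≥0∞) : Monotone fun r ↦ ∫⁻ x in ball x₀ r, f x :=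
  fun _ _ h ↦ lintegral_mono_set (ball_subset_ball h)

/-- Mollifying at radius `φ.rOut` bounds the energy and mass on B(x₀,r) by those of the original
functions on the slightly larger ball, and the trace bound is monotone in both. -/
theorem lintegral_surfaceMeasure_convolution_le (hN : 0 < N) {m : ℝ} (hm : m ∈ Ioo (0 : ℝ) 1)
    (x₀ : EuclideanSpace ℝ (Fin N)) {R r : ℝ} (hr : 0 < r)
    {u : EuclideanSpace ℝ (Fin N) → ℂ} {G : EuclideanSpace ℝ (Fin N) → EuclideanSpace ℂ (Fin N)}
    (hum : Measurable u) (hGm : Measurable G)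
    (hu : LocallyIntegrable u) (hG : LocallyIntegrable G)
    (hw : ∀ φ : EuclideanSpace ℝ (Fin N) → ℝ,
      ContDiff ℝ ∞ φ → HasCompactSupport φ → tsupport φ ⊆ ball x₀ R → ∀ i : Fin N,
        ∫ x, u x * (fderiv ℝ φ x (EuclideanSpace.single i 1) : ℂ) = -∫ x, G x i * (φ x : ℂ))
    (φ : ContDiffBump (0 : EuclideanSpace ℝ (Fin N))) (hφ : r + φ.rOut < R)
    (hE : ∫⁻ x in ball x₀ (r + φ.rOut), ‖G x‖ₑ ^ 2 ≠ ⊤)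
    (hb : ∫⁻ x in ball x₀ (r + φ.rOut), ‖u x‖ₑ ^ (m + 1) ≠ ⊤) :
    ∫⁻ x, ‖convolution (φ.normed volume) u (ContinuousLinearMap.lsmul ℝ ℝ) volume x‖ₑ ^ 2
        ∂(surfaceMeasure x₀ r) ≤
      traceBound N m r (∫⁻ x in ball x₀ (r + φ.rOut), ‖G x‖ₑ ^ 2)
        (∫⁻ x in ball x₀ (r + φ.rOut), ‖u x‖ₑ ^ (m + 1)) := by
  set η := φ.normed volume
  have hη : ContDiff ℝ ∞ η := φ.contDiff_normed
  have hη0 : ∀ y, 0 ≤ η y := φ.nonneg_normed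
  set v := convolution η u (ContinuousLinearMap.lsmul ℝ ℝ) volume
  have hηm : Measurable fun y ↦ ENNReal.ofReal (η y) := hη.continuous.measurable.ennreal_ofReal
  have hη1 : ∫⁻ y, ENNReal.ofReal (η y) = 1 := by
    rw [← ofReal_integral_eq_lintegral_ofReal φ.integrable_normed (ae_of_all _ hη0),
      φ.integral_normed, ENNReal.ofReal_one]
  have hηs : ∀ y, y ∉ ball 0 φ.rOut → ENNReal.ofReal (η y) = 0 := by
    intro y hy
    rw [← φ.support_normed_eq (μ := volume), Function.notMem_support] at hy
    simp [η, hy]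
  have hv : ContDiff ℝ 1 v :=
    (φ.hasCompactSupport_normed).contDiff_convolution_left (n := 1) _ φ.contDiff_normed hu
  have hE1 : ∫⁻ x in ball x₀ r, ‖fderiv ℝ v x‖ₑ ^ 2 ≤
      ∫⁻ x in ball x₀ (r + φ.rOut), ‖G x‖ₑ ^ 2 := by
    have h := lintegral_ball_convolution_rpow_le x₀ (r := r) one_le_two hηm hGm.enorm hη1 hηs
    simp only [ENNReal.rpow_two] at h
    refine le_trans (setLIntegral_mono' measurableSet_ball fun x hx ↦ ?_) h
    gcongr
    refine enorm_fderiv_convolution_le hη hη0 (r := φ.rOut) ?_ hu hG hw ?_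
    · rw [φ.support_normed_eq]
      exact ball_subset_closedBall
    · refine (closedBall_subset_ball' (ε₂ := R) ?_)
      rw [mem_ball] at hx
      linarith
  have hb1 : ∫⁻ x in ball x₀ r, ‖v x‖ₑ ^ (m + 1) ≤
      ∫⁻ x in ball x₀ (r + φ.rOut), ‖u x‖ₑ ^ (m + 1) := by
    have h := lintegral_ball_convolution_rpow_le x₀ (r := r) (q := m + 1) (by linarith [hm.1])
      hηm hum.enorm hη1 hηs
    refine le_trans (setLIntegral_mono' measurableSet_ball fun x _ ↦ ?_) h
    have := hm.1
    gcongr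
    simp only [v]
    rw [convolution_lsmul]
    refine (enorm_integral_le_lintegral_enorm _).trans_eq (lintegral_congr fun y ↦ ?_)
    rw [enorm_smul, Real.enorm_of_nonneg (hη0 y)]
  exact (lintegral_surfaceMeasure_le_of_contDiff hN hm x₀ hr hv (ne_top_of_le_ne_top hE hE1)
    (ne_top_of_le_ne_top hb hb1)).trans (traceBound_mono hN hm r hE1 hb1)

/-- The mollifications converge almost everywhere, hence σ-almost everywhere on almost every sphere,
and Fatou's lemma applies there. -/
theorem ae_lintegral_surfaceMeasure_le_of_measurable (hN : 0 < N) {m : ℝ} (hm : m ∈ Ioo (0 : ℝ) 1)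
    (x₀ : EuclideanSpace ℝ (Fin N)) {R : ℝ}
    {u : EuclideanSpace ℝ (Fin N) → ℂ} {G : EuclideanSpace ℝ (Fin N) → EuclideanSpace ℂ (Fin N)}
    (hum : Measurable u) (hGm : Measurable G)
    (hu : LocallyIntegrable u) (hG : LocallyIntegrable G)
    (hw : ∀ φ : EuclideanSpace ℝ (Fin N) → ℝ,
      ContDiff ℝ ∞ φ → HasCompactSupport φ → tsupport φ ⊆ ball x₀ R → ∀ i : Fin N,
        ∫ x, u x * (fderiv ℝ φ x (EuclideanSpace.single i 1) : ℂ) = -∫ x, G x i * (φ x : ℂ))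
    (hE : ∀ r < R, ∫⁻ x in ball x₀ r, ‖G x‖ₑ ^ 2 ≠ ⊤)
    (hb : ∀ r < R, ∫⁻ x in ball x₀ r, ‖u x‖ₑ ^ (m + 1) ≠ ⊤) :
    ∀ᵐ r ∂(volume.restrict (Ioo 0 R)), ∫⁻ x, ‖u x‖ₑ ^ 2 ∂(surfaceMeasure x₀ r) ≤
      traceBound N m r (∫⁻ x in ball x₀ r, ‖G x‖ₑ ^ 2) (∫⁻ x in ball x₀ r, ‖u x‖ₑ ^ (m + 1)) := by
  set φ : ℕ → ContDiffBump (0 : EuclideanSpace ℝ (Fin N)) := fun n ↦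
    ⟨1 / (n + 1 : ℝ), 2 * (1 / (n + 1 : ℝ)), by positivity, by
      have : 0 < 1 / (n + 1 : ℝ) := by positivity
      linarith⟩ with hφdef
  have hφ : Filter.Tendsto (fun n ↦ (φ n).rOut) Filter.atTop (nhds 0) := by
    simpa [hφdef] using (tendsto_one_div_add_atTop_nhds_zero_nat (𝕜 := ℝ)).const_mul 2
  have hconv := ContDiffBump.ae_convolution_tendsto_right_of_locallyIntegrable (K := 2) hφ
    (Filter.Eventually.of_forall fun n ↦ le_rfl) hu
  -- The enlarged balls must shrink back without loss in the limit, so the countably many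
  -- discontinuity radii of these monotone functions are discarded.
  have hc1 := ((monotone_setLIntegral_ball x₀ fun x ↦
    ‖G x‖ₑ ^ 2).countable_not_continuousAt).ae_notMem (volume.restrict (Ioo 0 R))
  have hc2 := ((monotone_setLIntegral_ball x₀ fun x ↦
    ‖u x‖ₑ ^ (m + 1)).countable_not_continuousAt).ae_notMem (volume.restrict (Ioo 0 R))
  filter_upwards [ae_surfaceMeasure_of_ae_ball hN x₀ R (ae_restrict_of_ae hconv), hc1, hc2,
    ae_restrict_mem measurableSet_Ioo] with r hr hr1 hr2 hr3
  simp only [not_not] at hr1 hr2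
  set v : ℕ → EuclideanSpace ℝ (Fin N) → ℂ := fun n ↦
    convolution ((φ n).normed volume) u (ContinuousLinearMap.lsmul ℝ ℝ) volume
  have hvm (n : ℕ) : Measurable fun x ↦ ‖v n x‖ₑ ^ 2 := by
    have : Continuous (v n) := ((φ n).hasCompactSupport_normed.contDiff_convolution_left (n := 1)
      _ (φ n).contDiff_normed hu).continuous
    exact this.enorm.measurable.pow_const 2
  have hfatou : ∫⁻ x, ‖u x‖ₑ ^ 2 ∂(surfaceMeasure x₀ r) ≤
      Filter.liminf (fun n ↦ ∫⁻ x, ‖v n x‖ₑ ^ 2 ∂(surfaceMeasure x₀ r)) Filter.atTop := by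
    refine le_trans (lintegral_mono_ae ?_) (lintegral_liminf_le hvm)
    filter_upwards [hr] with x hx
    exact (((ENNReal.continuous_pow 2).tendsto _).comp hx.enorm).liminf_eq.ge
  refine hfatou.trans ?_
  have hlim : Filter.Tendsto (fun n ↦ traceBound N m r
      (∫⁻ x in ball x₀ (r + (φ n).rOut), ‖G x‖ₑ ^ 2)
      (∫⁻ x in ball x₀ (r + (φ n).rOut), ‖u x‖ₑ ^ (m + 1))) Filter.atTop
      (nhds (traceBound N m r (∫⁻ x in ball x₀ r, ‖G x‖ₑ ^ 2)
        (∫⁻ x in ball x₀ r, ‖u x‖ₑ ^ (m + 1)))) := by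
    have h0 : Filter.Tendsto (fun n ↦ r + (φ n).rOut) Filter.atTop (nhds r) := by
      simpa using hφ.const_add r
    exact tendsto_traceBound hN hm r (hE r hr3.2) (hb r hr3.2) (hr1.tendsto.comp h0)
      (hr2.tendsto.comp h0)
  rw [← hlim.liminf_eq]
  refine Filter.liminf_le_liminf ?_
  have h1 : ∀ᶠ n in Filter.atTop, (φ n).rOut < R - r :=
    hφ.eventually_lt_const (sub_pos.2 hr3.2)
  filter_upwards [h1] with n hn
  have hn' : r + (φ n).rOut < R := by linarith
  exact lintegral_surfaceMeasure_convolution_le hN hm x₀ hr3.1 hum hGm hu hG hw (φ n) hn'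
    (hE _ hn') (hb _ hn')

end SobolevTrace

/-! ### Functions in H¹_loc of a ball. -/

section H1Loc

variable {N : ℕ}

theorem energy_eq_lintegral (x₀ : EuclideanSpace ℝ (Fin N))
    (G : EuclideanSpace ℝ (Fin N) → EuclideanSpace ℂ (Fin N)) (ρ : ℝ) :
    energy x₀ G ρ = ∫⁻ x in ball x₀ ρ, ‖G x‖ₑ ^ 2 := by
  rw [energy, eLpNorm_eq_lintegral_rpow_enorm_toReal two_ne_zero ENNReal.ofNat_ne_top,
    ← ENNReal.rpow_natCast, ← ENNReal.rpow_mul]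
  simp

theorem mass_eq_lintegral {m : ℝ} (hm : m ∈ Ioo (0 : ℝ) 1) (x₀ : EuclideanSpace ℝ (Fin N))
    (u : EuclideanSpace ℝ (Fin N) → ℂ) (ρ : ℝ) :
    mass m x₀ u ρ = ∫⁻ x in ball x₀ ρ, ‖u x‖ₑ ^ (m + 1) := by
  have h : 0 < m + 1 := by linarith [hm.1]
  rw [mass, eLpNorm_eq_lintegral_rpow_enorm_toReal (by simpa using h) ENNReal.ofReal_ne_top,
    ENNReal.toReal_ofReal h.le, ← ENNReal.rpow_mul, one_div_mul_cancel h.ne', ENNReal.rpow_one]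

theorem energy_mono (x₀ : EuclideanSpace ℝ (Fin N))
    (G : EuclideanSpace ℝ (Fin N) → EuclideanSpace ℂ (Fin N)) : Monotone (energy x₀ G) := by
  intro r s h
  rw [energy_eq_lintegral, energy_eq_lintegral]
  exact monotone_setLIntegral_ball x₀ _ h

theorem mass_mono {m : ℝ} (hm : m ∈ Ioo (0 : ℝ) 1) (x₀ : EuclideanSpace ℝ (Fin N))
    (u : EuclideanSpace ℝ (Fin N) → ℂ) : Monotone (mass m x₀ u) := by
  intro r s h
  rw [mass_eq_lintegral hm, mass_eq_lintegral hm]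
  exact monotone_setLIntegral_ball x₀ _ h

theorem ae_restrict_Ioo_of_forall_lt {a b : ℝ} {P : ℝ → Prop}
    (h : ∀ c < b, ∀ᵐ r ∂(volume.restrict (Ioo a c)), P r) :
    ∀ᵐ r ∂(volume.restrict (Ioo a b)), P r := by
  obtain ⟨s, -, hs, hlim⟩ := exists_seq_strictMono_tendsto b
  have hU : Ioo a b ⊆ ⋃ n, Ioo a (s n) := by
    intro r hr
    obtain ⟨n, hn⟩ := (hlim.eventually_const_lt hr.2).exists
    exact mem_iUnion.2 ⟨n, hr.1, hn⟩
  exact ae_restrict_of_ae_restrict_of_subset hU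
    ((ae_restrict_iUnion_iff _ _).2 fun n ↦ h _ (hs n))

theorem ae_restrict_ball_of_forall_lt {X : Type*} [PseudoMetricSpace X] [MeasurableSpace X]
    {μ : Measure X} {x₀ : X} {b : ℝ} {P : X → Prop}
    (h : ∀ c < b, ∀ᵐ x ∂(μ.restrict (ball x₀ c)), P x) :
    ∀ᵐ x ∂(μ.restrict (ball x₀ b)), P x := by
  obtain ⟨s, -, hs, hlim⟩ := exists_seq_strictMono_tendsto b
  have hU : ball x₀ b ⊆ ⋃ n, ball x₀ (s n) := by
    intro r hr
    obtain ⟨n, hn⟩ := (hlim.eventually_const_lt hr).exists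
    exact mem_iUnion.2 ⟨n, hn⟩
  exact ae_restrict_of_ae_restrict_of_subset hU
    ((ae_restrict_iUnion_iff _ _).2 fun n ↦ h _ (hs n))

variable {x₀ : EuclideanSpace ℝ (Fin N)} {ρ₀ : ℝ} {u : EuclideanSpace ℝ (Fin N) → ℂ}
  {G : EuclideanSpace ℝ (Fin N) → EuclideanSpace ℂ (Fin N)}

theorem IsH1LocWithGradient.memLp_ball (h : IsH1LocWithGradient (ball x₀ ρ₀) u G) {r : ℝ}
    (hr : r < ρ₀) : MemLp u 2 (volume.restrict (ball x₀ r)) :=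
  (h.memLp _ (closedBall_subset_ball hr) (isCompact_closedBall x₀ r)).mono_measure
    (Measure.restrict_mono_set _ ball_subset_closedBall)

theorem IsH1LocWithGradient.memLp_grad_ball (h : IsH1LocWithGradient (ball x₀ ρ₀) u G) {r : ℝ}
    (hr : r < ρ₀) : MemLp G 2 (volume.restrict (ball x₀ r)) :=
  (h.memLp_grad _ (closedBall_subset_ball hr) (isCompact_closedBall x₀ r)).mono_measure
    (Measure.restrict_mono_set _ ball_subset_closedBall)

theorem IsH1LocWithGradient.energy_ne_top (h : IsH1LocWithGradient (ball x₀ ρ₀) u G) {r : ℝ}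
    (hr : r < ρ₀) : energy x₀ G r ≠ ⊤ :=
  ENNReal.pow_ne_top (h.memLp_grad_ball hr).eLpNorm_ne_top

instance isFiniteMeasure_restrict_ball (r : ℝ) : IsFiniteMeasure (volume.restrict (ball x₀ r)) :=
  ⟨by simpa using measure_ball_lt_top⟩

theorem IsH1LocWithGradient.mass_ne_top (h : IsH1LocWithGradient (ball x₀ ρ₀) u G) {m : ℝ}
    (hm : m ∈ Ioo (0 : ℝ) 1) {r : ℝ} (hr : r < ρ₀) : mass m x₀ u r ≠ ⊤ := by
  have h1 : ENNReal.ofReal (m + 1) ≤ 2 := by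
    rw [← ENNReal.ofReal_ofNat]
    exact ENNReal.ofReal_le_ofReal (by linarith [hm.2])
  exact ENNReal.rpow_ne_top_of_nonneg (by linarith [hm.1])
    ((h.memLp_ball hr).mono_exponent h1).eLpNorm_ne_top

theorem ae_eq_indicator_mk {E F : Type*} [MeasurableSpace E] [TopologicalSpace F] [Zero F]
    {μ : Measure E} {s : Set E} (hs : MeasurableSet s) {f : E → F}
    (hf : AEStronglyMeasurable f (μ.restrict s)) :
    ∀ᵐ x ∂(μ.restrict s), s.indicator (hf.mk f) x = f x := by
  filter_upwards [hf.ae_eq_mk, ae_restrict_mem hs] with x hx hxs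
  rw [indicator_of_mem hxs, hx]

theorem setIntegral_eq_integral_of_ae_eq_of_eq_zero {E : Type*} [MeasurableSpace E]
    {μ : Measure E} {s t : Set E} (ht : MeasurableSet t) (hs : MeasurableSet s) (hts : t ⊆ s)
    {f g : E → ℂ}
    (hfg : ∀ᵐ x ∂(μ.restrict t), f x = g x) (hf : ∀ x ∉ t, f x = 0) (hg : ∀ x ∉ t, g x = 0) :
    ∫ x in s, f x ∂μ = ∫ x, g x ∂μ := by
  rw [← integral_indicator hs]
  refine integral_congr_ae ?_
  filter_upwards [(ae_restrict_iff' ht).1 hfg] with x hx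
  by_cases hxt : x ∈ t
  · rw [indicator_of_mem (hts hxt), hx hxt]
  · rw [hg x hxt]
    by_cases hxs : x ∈ s
    · rw [indicator_of_mem hxs, hf x hxt]
    · rw [indicator_of_notMem hxs]

/-- Interpolation-trace inequality for `H¹_loc` functions on almost every sphere. -/
theorem IsH1LocWithGradient.ae_lintegral_surfaceMeasure_le
    (h : IsH1LocWithGradient (ball x₀ ρ₀) u G) (hN : 0 < N) {m : ℝ} (hm : m ∈ Ioo (0 : ℝ) 1) :
    ∀ᵐ r ∂(volume.restrict (Ioo 0 ρ₀)), ∫⁻ x, ‖u x‖ₑ ^ 2 ∂(surfaceMeasure x₀ r) ≤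
      traceBound N m r (energy x₀ G r) (mass m x₀ u r) := by
  refine ae_restrict_Ioo_of_forall_lt fun R hR ↦ ?_
  have hu := h.memLp_ball hR
  have hG := h.memLp_grad_ball hR
  -- Borel versions cut off at a radius R < ρ₀ are globally integrable and agree almost everywhere
  -- with u and G on B(x₀,R), where all test functions used are supported.
  set u' := (ball x₀ R).indicator (hu.1.mk u)
  set G' := (ball x₀ R).indicator (hG.1.mk G)
  have hu' : ∀ᵐ x ∂(volume.restrict (ball x₀ R)), u' x = u x :=
    ae_eq_indicator_mk measurableSet_ball hu.1
  have hG' : ∀ᵐ x ∂(volume.restrict (ball x₀ R)), G' x = G x :=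
    ae_eq_indicator_mk measurableSet_ball hG.1
  have hu0 : ∀ x ∉ ball x₀ R, u' x = 0 := fun x hx ↦ indicator_of_notMem hx _
  have hG0 : ∀ x ∉ ball x₀ R, G' x = 0 := fun x hx ↦ indicator_of_notMem hx _
  have hum : Measurable u' := hu.1.stronglyMeasurable_mk.measurable.indicator measurableSet_ball
  have hGm : Measurable G' := hG.1.stronglyMeasurable_mk.measurable.indicator measurableSet_ball
  have hui : Integrable u' := by
    rw [integrable_indicator_iff measurableSet_ball]
    exact (hu.integrable one_le_two).congr hu.1.ae_eq_mk
  have hGi : Integrable G' := by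
    rw [integrable_indicator_iff measurableSet_ball]
    exact (hG.integrable one_le_two).congr hG.1.ae_eq_mk
  have hsub (r : ℝ) (hr : r ≤ R) : volume.restrict (ball x₀ r) ≤ volume.restrict (ball x₀ R) :=
    Measure.restrict_mono_set _ (ball_subset_ball hr)
  have hE (r : ℝ) (hr : r ≤ R) : ∫⁻ x in ball x₀ r, ‖G' x‖ₑ ^ 2 = energy x₀ G r := by
    rw [energy_eq_lintegral]
    refine lintegral_congr_ae ?_
    filter_upwards [ae_mono (hsub r hr) hG'] with x hx
    rw [hx]
  have hb (r : ℝ) (hr : r ≤ R) : ∫⁻ x in ball x₀ r, ‖u' x‖ₑ ^ (m + 1) = mass m x₀ u r := by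
    rw [mass_eq_lintegral hm]
    refine lintegral_congr_ae ?_
    filter_upwards [ae_mono (hsub r hr) hu'] with x hx
    rw [hx]
  have hw : ∀ φ : EuclideanSpace ℝ (Fin N) → ℝ,
      ContDiff ℝ ∞ φ → HasCompactSupport φ → tsupport φ ⊆ ball x₀ R → ∀ i : Fin N,
        ∫ x, u' x * (fderiv ℝ φ x (EuclideanSpace.single i 1) : ℂ) =
          -∫ x, G' x i * (φ x : ℂ) := by
    intro φ hφ hφc hφs i
    have hsub : ball x₀ R ⊆ ball x₀ ρ₀ := ball_subset_ball hR.le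
    have hφ0 : ∀ x ∉ ball x₀ R, φ x = 0 := fun x hx ↦
      image_eq_zero_of_notMem_tsupport fun hx' ↦ hx (hφs hx')
    have hφ1 : ∀ x ∉ ball x₀ R, fderiv ℝ φ x = 0 := fun x hx ↦
      image_eq_zero_of_notMem_tsupport fun hx' ↦ hx (hφs (tsupport_fderiv_subset ℝ hx'))
    have key := h.isWeakGradientOn.integral_eq φ hφ hφc (hφs.trans hsub) i
    rw [setIntegral_eq_integral_of_ae_eq_of_eq_zero measurableSet_ball measurableSet_ball hsub
      (g := fun x ↦ u' x * (fderiv ℝ φ x (EuclideanSpace.single i 1) : ℂ))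
      (hu'.mono fun x hx ↦ by simp only [hx]) (fun x hx ↦ by simp [hφ1 x hx])
      (fun x hx ↦ by simp [hφ1 x hx]),
      setIntegral_eq_integral_of_ae_eq_of_eq_zero measurableSet_ball measurableSet_ball hsub
      (g := fun x ↦ G' x i * (φ x : ℂ))
      (hG'.mono fun x hx ↦ by simp only [hx]) (fun x hx ↦ by simp [hφ0 x hx])
      (fun x hx ↦ by simp [hφ0 x hx])] at key
    exact key
  have key := ae_lintegral_surfaceMeasure_le_of_measurable hN hm x₀ (R := R) hum hGm
    hui.locallyIntegrable hGi.locallyIntegrable hw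
    (fun r hr ↦ by rw [hE r hr.le]; exact h.energy_ne_top (hr.trans hR))
    (fun r hr ↦ by rw [hb r hr.le]; exact h.mass_ne_top hm (hr.trans hR))
  filter_upwards [key, ae_surfaceMeasure_of_ae_ball hN x₀ R hu',
    ae_restrict_mem measurableSet_Ioo] with r h1 h2 h3
  rw [hE r h3.2.le, hb r h3.2.le] at h1
  refine le_trans (lintegral_mono_ae ?_) h1
  filter_upwards [h2] with x hx
  rw [hx]

end H1Loc

/-! ### The differential inequality for the energy. -/

section DifferentialInequality

variable {N : ℕ}

theorem gammaExp_mem_Ioo (N : ℕ) {m τ : ℝ} (hm : m ∈ Ioo (0 : ℝ) 1)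
    (hτ : τ ∈ Ioc ((m + 1) / 2) 1) : gammaExp N m τ ∈ Ioo (0 : ℝ) 1 := by
  have hk := kExp_pos N hm
  refine ⟨div_pos (by linarith [hτ.1]) hk, ?_⟩
  rw [gammaExp, div_lt_one hk, kExp]
  have h1 : 0 ≤ N * (1 - m) := mul_nonneg (by positivity) (by linarith [hm.2])
  linarith [hτ.2, hm.1]

theorem muExp_nonneg (N : ℕ) {m τ : ℝ} (hm : m ∈ Ioo (0 : ℝ) 1) (hτ : τ ≤ 1) :
    0 ≤ muExp N m τ :=
  div_nonneg (by linarith) (kExp_pos N hm).le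

theorem etaExp_pos (N : ℕ) {m τ : ℝ} (hm : m ∈ Ioo (0 : ℝ) 1) (hτ : τ ≤ 1) :
    0 < etaExp N m τ := by
  have hk := kExp_pos N hm
  have h0 : 0 < m + 1 := by linarith [hm.1]
  have hm1 : 0 < 1 - m := by linarith [hm.2]
  have h1 : 0 ≤ N * (1 - m) := mul_nonneg (by positivity) hm1.le
  have h2 : 1 + m < kExp N m := by
    rw [kExp]
    linarith
  rw [etaExp, gammaExp, sub_pos]
  calc (2 * τ - (1 + m)) / kExp N m ≤ (1 - m) / kExp N m :=
        div_le_div_of_nonneg_right (by linarith) hk.le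
    _ < (1 - m) / (1 + m) := div_lt_div_of_pos_left hm1 (by linarith) h2

theorem max_one_rpow {x s : ℝ} (hx : 0 ≤ x) (hs : 0 ≤ s) : (max 1 x) ^ s = max 1 (x ^ s) := by
  rcases le_total 1 x with h | h
  · rw [max_eq_right h, max_eq_right (Real.one_le_rpow h hs)]
  · rw [max_eq_left h, max_eq_left (Real.rpow_le_one hx h hs), Real.one_rpow]

/-- With θ = 1 - 1/ν and s = 2/(m+1) - 1, split 2/k = μ + 2τ/k and b^(2/(m+1)) = b^s b, and replace
b by b₀ in the powers μ and s. The exponents match because μ + sθ = η and 2τ/k + θ = 1 + γ, while νθ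
= ν - 1 gives the weight in r. -/
theorem rpow_add_mul_rpow_le {m E b b₀ r ρ₀ τ : ℝ} (hN : 0 < N) (hm : m ∈ Ioo (0 : ℝ) 1)
    (hτ : τ ∈ Ioc ((m + 1) / 2) 1) (hE : 0 < E) (hb : 0 ≤ b) (hb₀ : b ≤ b₀) (hr : 0 < r)
    (hrρ : r ≤ ρ₀) :
    b ^ (2 / kExp N m) * (E + r ^ (-nuExp N m) * b ^ (2 / (m + 1))) ^ (1 - 1 / nuExp N m) ≤
      r ^ (-(nuExp N m - 1)) * (max (ρ₀ ^ (nuExp N m - 1)) 1 *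
        max (b₀ ^ muExp N m τ) (b₀ ^ etaExp N m τ)) * (E + b) ^ (1 + gammaExp N m τ) := by
  have hρ₀ : 0 < ρ₀ := hr.trans_le hrρ
  have hb₀0 : 0 ≤ b₀ := hb.trans hb₀
  have hk := kExp_pos N hm
  have hθ := one_sub_inv_nuExp_pos hN hm
  have hν := two_lt_nuExp hN hm
  have hm1 : 0 < m + 1 := by linarith [hm.1]
  have hτ0 : 0 < τ := by linarith [hτ.1, hm.1]
  set ν := nuExp N m
  set θ := 1 - 1 / ν with hθdef
  have hμ := muExp_nonneg N hm hτ.2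
  have hs : 0 < 2 / (m + 1) - 1 := by
    rw [sub_pos, one_lt_div hm1]
    linarith [hm.2]
  set s := 2 / (m + 1) - 1 with hsdef
  have hνθ : ν * θ = ν - 1 := by
    rw [hθdef]
    field_simp
  have hθk : θ = 1 - (m + 1) / kExp N m := by
    rw [hθdef]
    simp only [ν, nuExp, one_div_div]
  have e1 : b ^ (2 / kExp N m) ≤ b₀ ^ muExp N m τ * (E + b) ^ (2 * τ / kExp N m) := by
    have h1 : 2 / kExp N m = muExp N m τ + 2 * τ / kExp N m := by
      rw [muExp]
      ring
    rw [h1, Real.rpow_add_of_nonneg hb hμ (by positivity)]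
    gcongr
    linarith
  have e2 : E + r ^ (-ν) * b ^ (2 / (m + 1)) ≤
      r ^ (-ν) * max 1 (ρ₀ ^ ν) * max 1 (b₀ ^ s) * (E + b) := by
    have h1 : E ≤ r ^ (-ν) * max 1 (ρ₀ ^ ν) * max 1 (b₀ ^ s) * E := by
      refine le_mul_of_one_le_left hE.le (one_le_mul_of_one_le_of_one_le ?_ (le_max_left _ _))
      calc (1 : ℝ) = r ^ (-ν) * r ^ ν := by rw [← Real.rpow_add hr, neg_add_cancel, Real.rpow_zero]
        _ ≤ r ^ (-ν) * max 1 (ρ₀ ^ ν) := by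
          gcongr
          exact (Real.rpow_le_rpow hr.le hrρ (by linarith)).trans (le_max_right _ _)
    have h2 : r ^ (-ν) * b ^ (2 / (m + 1)) ≤ r ^ (-ν) * max 1 (ρ₀ ^ ν) * max 1 (b₀ ^ s) * b := by
      have h3 : b ^ (2 / (m + 1)) = b ^ s * b := by
        rw [show 2 / (m + 1) = s + 1 by rw [hsdef]; ring,
          Real.rpow_add_of_nonneg hb hs.le zero_le_one, Real.rpow_one]
      rw [h3]
      calc _ = r ^ (-ν) * 1 * b ^ s * b := by ring
        _ ≤ _ := by
          gcongr
          · exact le_max_left _ _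
          · exact (Real.rpow_le_rpow hb hb₀ hs.le).trans (le_max_right _ _)
    linarith
  have e3 : (E + r ^ (-ν) * b ^ (2 / (m + 1))) ^ θ ≤
      r ^ (-(ν - 1)) * max 1 (ρ₀ ^ (ν - 1)) * max 1 (b₀ ^ (s * θ)) * (E + b) ^ θ := by
    refine (Real.rpow_le_rpow (by positivity) e2 hθ.le).trans_eq ?_
    rw [Real.mul_rpow (by positivity) (by positivity), Real.mul_rpow (by positivity) (by positivity),
      Real.mul_rpow (by positivity) (by positivity), max_one_rpow (by positivity) hθ.le,
      max_one_rpow (by positivity) hθ.le, ← Real.rpow_mul hr.le, ← Real.rpow_mul hρ₀.le,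
      ← Real.rpow_mul hb₀0, neg_mul, hνθ]
  have e4 : b₀ ^ muExp N m τ * max 1 (b₀ ^ (s * θ)) =
      max (b₀ ^ muExp N m τ) (b₀ ^ etaExp N m τ) := by
    rw [mul_max_of_nonneg _ _ (by positivity), mul_one,
      ← Real.rpow_add_of_nonneg hb₀0 hμ (by positivity)]
    congr 2
    rw [hθk, etaExp, muExp, gammaExp, hsdef]
    have : 1 + m ≠ 0 := by linarith
    field_simp
    ring
  have e5 : (E + b) ^ (2 * τ / kExp N m) * (E + b) ^ θ = (E + b) ^ (1 + gammaExp N m τ) := by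
    rw [← Real.rpow_add (by positivity), hθk, gammaExp]
    congr 1
    ring
  calc _ ≤ (b₀ ^ muExp N m τ * (E + b) ^ (2 * τ / kExp N m)) * (r ^ (-(ν - 1)) *
          max 1 (ρ₀ ^ (ν - 1)) * max 1 (b₀ ^ (s * θ)) * (E + b) ^ θ) := by gcongr
    _ = r ^ (-(ν - 1)) * (max (ρ₀ ^ (ν - 1)) 1 * (b₀ ^ muExp N m τ * max 1 (b₀ ^ (s * θ)))) *
          ((E + b) ^ (2 * τ / kExp N m) * (E + b) ^ θ) := by
        rw [max_comm 1 (ρ₀ ^ (ν - 1))]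
        ring
    _ = _ := by rw [e4, e5]

/-- Replacing E + Lb by E + b costs max(1, 1/L²). Dividing by (E+b)^(1+γ) leaves (E+b)^(1-γ), which
dominates E^(1-γ) since γ < 1. -/
theorem rpow_mul_energy_rpow_le {m E b b₀ r ρ₀ τ L M e K : ℝ} (hN : 0 < N)
    (hm : m ∈ Ioo (0 : ℝ) 1)
    (hτ : τ ∈ Ioc ((m + 1) / 2) 1) (hE : 0 < E) (hb : 0 ≤ b) (hb₀ : b ≤ b₀) (hr : 0 < r)
    (hrρ : r ≤ ρ₀) (hL : 0 < L) (he : 0 ≤ e) (hK : 0 ≤ K)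
    (h : (E + L * b) ^ 2 ≤ M ^ 2 * (K * (b ^ (2 / kExp N m) *
      (E + r ^ (-nuExp N m) * b ^ (2 / (m + 1))) ^ (1 - 1 / nuExp N m)) * e)) :
    r ^ (nuExp N m - 1) * E ^ (1 - gammaExp N m τ) ≤
      K * M ^ 2 * max 1 (1 / L ^ 2) * max (ρ₀ ^ (nuExp N m - 1)) 1 *
        max (b₀ ^ muExp N m τ) (b₀ ^ etaExp N m τ) * e := by
  have hγ := gammaExp_mem_Ioo N hm hτ
  have hEb : 0 < E + b := by positivity
  set B := max (ρ₀ ^ (nuExp N m - 1)) 1 * max (b₀ ^ muExp N m τ) (b₀ ^ etaExp N m τ) with hB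
  have h1 : (E + b) ^ 2 ≤ max 1 (1 / L ^ 2) * (E + L * b) ^ 2 := by
    rcases le_total 1 L with hL1 | hL1
    · calc (E + b) ^ 2 ≤ 1 * (E + L * b) ^ 2 := by
            rw [one_mul]
            gcongr
            nlinarith
        _ ≤ _ := by gcongr; exact le_max_left _ _
    · calc (E + b) ^ 2 ≤ ((E + L * b) / L) ^ 2 := by
            gcongr
            rw [le_div_iff₀ hL]
            nlinarith
        _ = 1 / L ^ 2 * (E + L * b) ^ 2 := by ring
        _ ≤ _ := by gcongr; exact le_max_right _ _
  have h2 : (E + b) ^ (1 - gammaExp N m τ) * (E + b) ^ (1 + gammaExp N m τ) ≤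
      (r ^ (-(nuExp N m - 1)) * (K * M ^ 2 * max 1 (1 / L ^ 2) * B * e)) *
        (E + b) ^ (1 + gammaExp N m τ) := by
    rw [← Real.rpow_add hEb, show 1 - gammaExp N m τ + (1 + gammaExp N m τ) = 2 by ring,
      Real.rpow_two]
    calc (E + b) ^ 2 ≤ max 1 (1 / L ^ 2) * (M ^ 2 * (K * (r ^ (-(nuExp N m - 1)) * B *
            (E + b) ^ (1 + gammaExp N m τ)) * e)) := by
          refine h1.trans ?_
          gcongr
          refine h.trans ?_
          have := rpow_add_mul_rpow_le hN hm hτ hE hb hb₀ hr hrρ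
          gcongr M ^ 2 * (K * ?_ * e)
      _ = _ := by ring
  have h3 := le_of_mul_le_mul_right h2 (by positivity)
  calc _ ≤ r ^ (nuExp N m - 1) * (r ^ (-(nuExp N m - 1)) *
          (K * M ^ 2 * max 1 (1 / L ^ 2) * B * e)) := by
        gcongr
        refine le_trans ?_ h3
        exact Real.rpow_le_rpow hE.le (by linarith) (by linarith [hγ.2])
    _ = _ := by
        rw [← mul_assoc, ← Real.rpow_add hr, add_neg_cancel, Real.rpow_zero, hB]
        ring

/-- Multiplying the inequality by γ E^(γ-1) turns it into γ r^(ν-1) ≤ C (E^γ)', which is then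
integrated over [a,R]. Positivity at a and monotonicity keep E away from 0. -/
theorem rpow_sub_rpow_le_of_differential_inequality {ν γ C a R : ℝ} {E e : ℝ → ℝ} (hν : 1 < ν)
    (hγ : 0 < γ) (hC : 0 ≤ C) (ha : 0 < a) (haR : a ≤ R)
    (he : IntervalIntegrable e volume 0 R) (hEe : ∀ r ∈ Icc 0 R, E r = ∫ s in 0..r, e s)
    (hmono : MonotoneOn E (Icc 0 R)) (hEa : 0 < E a)
    (h : ∀ᵐ r, r ∈ Ioo a R → r ^ (ν - 1) * E r ^ (1 - γ) ≤ C * e r) :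
    γ * (R ^ ν - a ^ ν) ≤ ν * C * E R ^ γ := by
  have hsub : Icc a R ⊆ Icc 0 R := Icc_subset_Icc_left ha.le
  have hpos : ∀ r ∈ Icc a R, 0 < E r := fun r hr ↦
    hEa.trans_le (hmono (hsub ⟨le_rfl, haR⟩) (hsub hr) hr.1)
  have hF : MonotoneOn (fun r ↦ E r ^ γ) (uIcc a R) := by
    rw [uIcc_of_le haR]
    intro x hx y hy hxy
    exact Real.rpow_le_rpow (hpos x hx).le (hmono (hsub hx) (hsub hy) hxy) hγ.le
  have hFR : E a ^ γ ≤ E R ^ γ := hF left_mem_uIcc right_mem_uIcc haR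
  -- Monotonicity of E^γ suffices: the integral of its derivative is at most its increment, and
  -- E(a)^γ is dropped.
  have h1 : ∫ r in a..R, deriv (fun r ↦ E r ^ γ) r ≤ E R ^ γ := by
    have := hF.intervalIntegral_deriv_mem_uIcc
    rw [uIcc_of_le (by linarith)] at this
    have h0 : 0 < E a ^ γ := Real.rpow_pos_of_pos hEa _
    linarith [this.2]
  have h2 : ∫ r in a..R, γ * r ^ (ν - 1) ≤ ∫ r in a..R, C * deriv (fun r ↦ E r ^ γ) r := by
    refine intervalIntegral.integral_mono_ae_restrict haR ?_
      (hF.intervalIntegrable_deriv.const_mul C) ?_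
    · exact (intervalIntegral.intervalIntegrable_rpow' (by linarith)).const_mul γ
    rw [← restrict_Ioo_eq_restrict_Icc, Filter.EventuallyLE, ae_restrict_iff' measurableSet_Ioo]
    have hd := he.ae_hasDerivAt_integral
    rw [uIcc_of_le (ha.le.trans haR)] at hd
    filter_upwards [h, hd] with r hr hdr hrm
    have hr0 : 0 < r := ha.trans hrm.1
    have hEr : 0 < E r := hpos r ⟨hrm.1.le, hrm.2.le⟩
    have hderiv : HasDerivAt E (e r) r := by
      refine (hdr ⟨hr0.le, hrm.2.le⟩ 0 ⟨le_rfl, ha.le.trans haR⟩).congr_of_eventuallyEq ?_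
      filter_upwards [Ioo_mem_nhds hr0 hrm.2] with s hs
      exact hEe s ⟨hs.1.le, hs.2.le⟩
    rw [(hderiv.rpow_const (Or.inl hEr.ne')).deriv]
    have h3 := mul_le_mul_of_nonneg_right (hr hrm)
      (show 0 ≤ γ * E r ^ (γ - 1) by positivity)
    calc γ * r ^ (ν - 1) = r ^ (ν - 1) * E r ^ (1 - γ) * (γ * E r ^ (γ - 1)) := by
          have : E r ^ (1 - γ) * E r ^ (γ - 1) = 1 := by
            rw [← Real.rpow_add hEr]
            simp
          linear_combination (-γ * r ^ (ν - 1)) * this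
      _ ≤ _ := h3
      _ = _ := by ring
  rw [intervalIntegral.integral_const_mul, intervalIntegral.integral_const_mul,
    integral_rpow (Or.inl (by linarith)), sub_add_cancel] at h2
  have h3 : γ * ((R ^ ν - a ^ ν) / ν) ≤ C * E R ^ γ := h2.trans (by gcongr)
  calc γ * (R ^ ν - a ^ ν) = ν * (γ * ((R ^ ν - a ^ ν) / ν)) := by field_simp
    _ ≤ ν * (C * E R ^ γ) := by gcongr
    _ = _ := by ring

/-- Cauchy–Schwarz twice: pointwise against the radial direction, whose norm is at most 1, and then
on the sphere. -/
theorem enorm_boundaryFlux_sq_le {x₀ : EuclideanSpace ℝ (Fin N)}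
    {u : EuclideanSpace ℝ (Fin N) → ℂ} {G : EuclideanSpace ℝ (Fin N) → EuclideanSpace ℂ (Fin N)}
    {r : ℝ} (hu : AEMeasurable u (surfaceMeasure x₀ r))
    (hG : AEMeasurable G (surfaceMeasure x₀ r)) :
    ‖boundaryFlux x₀ u G r‖ₑ ^ 2 ≤ (∫⁻ x, ‖u x‖ₑ ^ 2 ∂(surfaceMeasure x₀ r)) *
      ∫⁻ x, ‖G x‖ₑ ^ 2 ∂(surfaceMeasure x₀ r) := by
  refine le_trans ?_ (sq_lintegral_mul_le _ hu.enorm hG.enorm)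
  gcongr
  refine (enorm_integral_le_lintegral_enorm _).trans (lintegral_mono fun x ↦ ?_)
  rw [enorm_mul]
  gcongr
  rw [← ofReal_norm, ← ofReal_norm]
  refine ENNReal.ofReal_le_ofReal ?_
  set n : EuclideanSpace ℝ (Fin N) := ‖x - x₀‖⁻¹ • (x - x₀) with hn
  have h1 : ∑ i, conj (G x i) * (((x - x₀) i / ‖x - x₀‖ : ℝ) : ℂ) =
      conj (∑ i, G x i * (n i : ℂ)) := by
    rw [map_sum]
    refine Finset.sum_congr rfl fun i _ ↦ ?_
    rw [map_mul, Complex.conj_ofReal, hn, PiLp.smul_apply, smul_eq_mul, div_eq_inv_mul]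
  rw [h1, Complex.norm_conj]
  refine (norm_sum_mul_ofReal_le _ _).trans (mul_le_of_le_one_right (norm_nonneg _) ?_)
  rw [hn, norm_smul, norm_inv, norm_norm]
  exact inv_mul_le_one

end DifferentialInequality

/-! ### Attainment of the minimum over τ. -/

section Minimum

theorem tauTerm_ofReal {N : ℕ} {m τ E b : ℝ} (hm : m ∈ Ioo (0 : ℝ) 1)
    (hτ : τ ∈ Ioc ((m + 1) / 2) 1) (hE : 0 ≤ E) (hb : 0 ≤ b) :
    tauTerm N m (ENNReal.ofReal E) (ENNReal.ofReal b) τ =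
      ENNReal.ofReal (E ^ gammaExp N m τ * max (b ^ muExp N m τ) (b ^ etaExp N m τ) /
        (2 * τ - (1 + m))) := by
  rw [tauTerm, ENNReal.ofReal_rpow_of_nonneg hE (gammaExp_mem_Ioo N hm hτ).1.le,
    ENNReal.ofReal_rpow_of_nonneg hb (muExp_nonneg N hm hτ.2),
    ENNReal.ofReal_rpow_of_nonneg hb (etaExp_pos N hm hτ.2).le, ← ENNReal.ofReal_max,
    ← ENNReal.ofReal_mul (by positivity), ENNReal.ofReal_div_of_pos (by linarith [hτ.1])]

theorem tauTerm_eq_top {N : ℕ} {m τ : ℝ} {E b : ℝ≥0∞} (hm : m ∈ Ioo (0 : ℝ) 1)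
    (hτ : τ ∈ Ioc ((m + 1) / 2) 1) (hE : E ≠ 0) (hb : b ≠ 0) (h : E = ⊤ ∨ b = ⊤) :
    tauTerm N m E b τ = ⊤ := by
  have hγ := (gammaExp_mem_Ioo N hm hτ).1
  have hη := etaExp_pos N hm hτ.2
  have h1 : E ^ gammaExp N m τ ≠ 0 := by simp [ENNReal.rpow_eq_zero_iff, hE, hγ.le]
  have h2 : max (b ^ muExp N m τ) (b ^ etaExp N m τ) ≠ 0 := by
    refine (lt_max_of_lt_right (pos_iff_ne_zero.2 ?_)).ne'
    simp [ENNReal.rpow_eq_zero_iff, hb, hη.le]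
  have h3 : E ^ gammaExp N m τ * max (b ^ muExp N m τ) (b ^ etaExp N m τ) = ⊤ := by
    rcases h with rfl | rfl
    · rw [ENNReal.top_rpow_of_pos hγ, ENNReal.top_mul h2]
    · rw [ENNReal.top_rpow_of_pos hη, max_eq_right le_top, ENNReal.mul_top h1]
  rw [tauTerm, h3, ENNReal.top_div_of_ne_top ENNReal.ofReal_ne_top]

theorem exists_isMinOn_Ioc_of_tendsto_atTop {f : ℝ → ℝ} {a b : ℝ} (hab : a < b)
    (hf : ContinuousOn f (Ioc a b)) (hlim : Filter.Tendsto f (nhdsWithin a (Ioi a)) Filter.atTop) :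
    ∃ τ ∈ Ioc a b, IsMinOn f (Ioc a b) τ := by
  obtain ⟨c, hc, hc'⟩ := mem_nhdsGT_iff_exists_Ioc_subset.1
    ((hlim.eventually_ge_atTop (f b)).and (Ioc_mem_nhdsGT hab))
  obtain ⟨hcb1, hcb⟩ := hc' ⟨hc, le_rfl⟩
  have hsub : Icc c b ⊆ Ioc a b := fun x hx ↦ ⟨lt_of_lt_of_le hc hx.1, hx.2⟩
  obtain ⟨τ, hτ, hmin⟩ := isCompact_Icc.exists_isMinOn (nonempty_Icc.2 hcb.2) (hf.mono hsub)
  refine ⟨τ, hsub hτ, fun x hx ↦ ?_⟩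
  rcases le_total c x with h | h
  · exact hmin ⟨h, hx.2⟩
  · exact (hmin ⟨hcb.2, le_rfl⟩ : f τ ≤ f b).trans (hc' ⟨hx.1, h⟩).1

/-- For E and b positive and finite the function is continuous and blows up at the excluded
endpoint, where its denominator vanishes. In the degenerate cases either the value 0 is attained or
the function is identically ∞. -/
theorem exists_isMinOn_tauTerm {N : ℕ} {m : ℝ} (hm : m ∈ Ioo (0 : ℝ) 1) (E b : ℝ≥0∞) :
    ∃ τ₀ ∈ Ioc ((m + 1) / 2) 1, IsMinOn (tauTerm N m E b) (Ioc ((m + 1) / 2) 1) τ₀ := by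
  have ha : (m + 1) / 2 < 1 := by linarith [hm.2]
  have hk := kExp_pos N hm
  have of_eq_zero (τ : ℝ) (hτ : τ ∈ Ioc ((m + 1) / 2) 1) (h : tauTerm N m E b τ = 0) :
      ∃ τ₀ ∈ Ioc ((m + 1) / 2) 1, IsMinOn (tauTerm N m E b) (Ioc ((m + 1) / 2) 1) τ₀ :=
    ⟨τ, hτ, fun x _ ↦ by simp [h]⟩
  by_cases hE : E = 0
  · refine of_eq_zero 1 ⟨ha, le_rfl⟩ ?_
    rw [tauTerm, hE, ENNReal.zero_rpow_of_pos (gammaExp_mem_Ioo N hm ⟨ha, le_rfl⟩).1, zero_mul,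
      ENNReal.zero_div]
  by_cases hb : b = 0
  -- The endpoint τ = 1 can fail here, since μ(1) = 0 and 0⁰ = 1. The midpoint of the interval has μ
  -- > 0, which makes the term 0 even if E = ∞.
  · have hτ : (m + 3) / 4 ∈ Ioc ((m + 1) / 2) 1 := ⟨by linarith [hm.2], by linarith [hm.2]⟩
    refine of_eq_zero ((m + 3) / 4) hτ ?_
    have hμ : 0 < muExp N m ((m + 3) / 4) := div_pos (by linarith [hm.2]) hk
    rw [tauTerm, hb, ENNReal.zero_rpow_of_pos hμ, ENNReal.zero_rpow_of_pos (etaExp_pos N hm hτ.2),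
      max_self, mul_zero, ENNReal.zero_div]
  by_cases htop : E = ⊤ ∨ b = ⊤
  · exact ⟨1, ⟨ha, le_rfl⟩, fun x hx ↦ by simp [tauTerm_eq_top hm hx hE hb htop]⟩
  push Not at htop
  have hE0 := ENNReal.toReal_pos hE htop.1
  have hb0 := ENNReal.toReal_pos hb htop.2
  set f : ℝ → ℝ := fun τ ↦ E.toReal ^ gammaExp N m τ *
    max (b.toReal ^ muExp N m τ) (b.toReal ^ etaExp N m τ) / (2 * τ - (1 + m)) with hf
  have hnum : Continuous fun τ ↦ E.toReal ^ gammaExp N m τ *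
      max (b.toReal ^ muExp N m τ) (b.toReal ^ etaExp N m τ) := by
    have c1 : Continuous (gammaExp N m) := by unfold gammaExp; fun_prop
    have c2 : Continuous (muExp N m) := by unfold muExp; fun_prop
    have c3 : Continuous (etaExp N m) := by unfold etaExp; fun_prop
    exact (continuous_const.rpow c1 fun _ ↦ Or.inl hE0.ne').mul
      ((continuous_const.rpow c2 fun _ ↦ Or.inl hb0.ne').max
        (continuous_const.rpow c3 fun _ ↦ Or.inl hb0.ne'))
  have hcont : ContinuousOn f (Ioc ((m + 1) / 2) 1) := by
    refine hnum.continuousOn.div (by fun_prop) fun τ hτ ↦ ?_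
    linarith [hτ.1]
  have hlim : Filter.Tendsto f (nhdsWithin ((m + 1) / 2) (Ioi ((m + 1) / 2))) Filter.atTop := by
    have h1 : Filter.Tendsto (fun τ : ℝ ↦ 2 * τ - (1 + m))
        (nhdsWithin ((m + 1) / 2) (Ioi ((m + 1) / 2))) (nhdsWithin 0 (Ioi 0)) := by
      refine tendsto_nhdsWithin_iff.2 ⟨?_, ?_⟩
      · have : Continuous fun τ : ℝ ↦ 2 * τ - (1 + m) := by fun_prop
        refine (this.tendsto' _ _ ?_).mono_left nhdsWithin_le_nhds
        ring
      · filter_upwards [self_mem_nhdsWithin] with τ (hτ : _ < τ)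
        rw [mem_Ioi]
        linarith
    exact (hnum.tendsto _ |>.mono_left nhdsWithin_le_nhds).pos_mul_atTop (by positivity)
      (tendsto_inv_nhdsGT_zero.comp h1)
  obtain ⟨τ, hτ, hmin⟩ := exists_isMinOn_Ioc_of_tendsto_atTop ha hcont hlim
  have hfe : ∀ τ ∈ Ioc ((m + 1) / 2) 1, tauTerm N m E b τ = ENNReal.ofReal (f τ) := by
    intro τ hτ
    rw [← ENNReal.ofReal_toReal htop.1, ← ENNReal.ofReal_toReal htop.2,
      tauTerm_ofReal hm hτ hE0.le hb0.le]
  refine ⟨τ, hτ, fun x hx ↦ ?_⟩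
  rw [mem_ofPred_eq, hfe τ hτ, hfe x hx]
  exact ENNReal.ofReal_le_ofReal (hmin hx)

end Minimum

/-! ### Vanishing inside the radius ρ_max. -/

section VanishingRadius

variable {N : ℕ} {x₀ : EuclideanSpace ℝ (Fin N)} {ρ₀ : ℝ} {u : EuclideanSpace ℝ (Fin N) → ℂ}
  {G : EuclideanSpace ℝ (Fin N) → EuclideanSpace ℂ (Fin N)}

theorem IsH1LocWithGradient.energy_eq_setLIntegral (h : IsH1LocWithGradient (ball x₀ ρ₀) u G)
    (hN : 0 < N) {r : ℝ} (hr : r < ρ₀) :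
    energy x₀ G r = ∫⁻ s in Ioo 0 r, ∫⁻ x, ‖G x‖ₑ ^ 2 ∂(surfaceMeasure x₀ s) := by
  rw [energy_eq_lintegral, setLIntegral_ball_eq_lintegral_surfaceMeasure₀ hN]
  exact (h.memLp_grad_ball hr).1.enorm.pow_const 2

theorem IsH1LocWithGradient.aemeasurable_sphere_energy
    (h : IsH1LocWithGradient (ball x₀ ρ₀) u G) (hN : 0 < N) {r : ℝ} (hr : r < ρ₀) :
    AEMeasurable (fun s ↦ ∫⁻ x, ‖G x‖ₑ ^ 2 ∂(surfaceMeasure x₀ s)) (volume.restrict (Ioo 0 r)) :=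
  aemeasurable_lintegral_surfaceMeasure hN x₀ r ((h.memLp_grad_ball hr).1.enorm.pow_const 2)

theorem IsH1LocWithGradient.ae_sphere_energy_lt_top
    (h : IsH1LocWithGradient (ball x₀ ρ₀) u G) (hN : 0 < N) :
    ∀ᵐ s ∂(volume.restrict (Ioo 0 ρ₀)), ∫⁻ x, ‖G x‖ₑ ^ 2 ∂(surfaceMeasure x₀ s) < ⊤ := by
  refine ae_restrict_Ioo_of_forall_lt fun r hr ↦ ?_
  refine ae_lt_top' (h.aemeasurable_sphere_energy hN hr) ?_
  rw [← h.energy_eq_setLIntegral hN hr]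
  exact h.energy_ne_top hr

theorem IsH1LocWithGradient.intervalIntegrable_sphere_energy
    (h : IsH1LocWithGradient (ball x₀ ρ₀) u G) (hN : 0 < N) {r : ℝ} (hr0 : 0 ≤ r) (hr : r < ρ₀) :
    IntervalIntegrable (fun s ↦ (∫⁻ x, ‖G x‖ₑ ^ 2 ∂(surfaceMeasure x₀ s)).toReal) volume 0 r := by
  rw [intervalIntegrable_iff_integrableOn_Ioo_of_le hr0]
  refine integrable_toReal_of_lintegral_ne_top (h.aemeasurable_sphere_energy hN hr) ?_
  rw [← h.energy_eq_setLIntegral hN hr]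
  exact h.energy_ne_top hr

theorem IsH1LocWithGradient.toReal_energy_eq_integral
    (h : IsH1LocWithGradient (ball x₀ ρ₀) u G) (hN : 0 < N) {r : ℝ} (hr0 : 0 ≤ r) (hr : r < ρ₀) :
    (energy x₀ G r).toReal =
      ∫ s in 0..r, (∫⁻ x, ‖G x‖ₑ ^ 2 ∂(surfaceMeasure x₀ s)).toReal := by
  rw [h.energy_eq_setLIntegral hN hr, intervalIntegral.integral_of_le hr0,
    integral_Ioc_eq_integral_Ioo, integral_toReal (h.aemeasurable_sphere_energy hN hr)]
  exact ae_restrict_of_ae_restrict_of_subset (Ioo_subset_Ioo_right hr.le)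
    (h.ae_sphere_energy_lt_top hN)

theorem traceBound_ofReal (hN : 0 < N) {m ρ E b : ℝ} (hm : m ∈ Ioo (0 : ℝ) 1) (hρ : 0 < ρ)
    (hE : 0 ≤ E) (hb : 0 ≤ b) :
    traceBound N m ρ (ENNReal.ofReal E) (ENNReal.ofReal b) =
      ENNReal.ofReal (traceConst N * (b ^ (2 / kExp N m) *
        (E + ρ ^ (-nuExp N m) * b ^ (2 / (m + 1))) ^ (1 - 1 / nuExp N m))) := by
  have hk := kExp_pos N hm
  have hm0 := hm.1
  rw [traceBound, ENNReal.ofReal_rpow_of_nonneg hb (by positivity),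
    ENNReal.ofReal_rpow_of_nonneg hb (by positivity), ← ENNReal.ofReal_mul (by positivity),
    ← ENNReal.ofReal_add hE (by positivity),
    ENNReal.ofReal_rpow_of_nonneg (by positivity) (one_sub_inv_nuExp_pos hN hm).le,
    ← ENNReal.ofReal_mul (by positivity), ← ENNReal.ofReal_mul (traceConst_pos N).le]

/-- The flux hypothesis is squared and combined with Cauchy–Schwarz and the trace inequality. For
almost every r < ρ₀ all quantities are finite, so the result is stated over the reals. -/
theorem IsH1LocWithGradient.ae_energy_add_mass_sq_le
    (h : IsH1LocWithGradient (ball x₀ ρ₀) u G) (hN : 0 < N) {m : ℝ} (hm : m ∈ Ioo (0 : ℝ) 1)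
    {L M : ℝ} (hL : 0 < L) (hM : 0 < M)
    (hflux : ∀ᵐ ρ : ℝ, ρ ∈ Ioo 0 ρ₀ → energy x₀ G ρ + ENNReal.ofReal L * mass m x₀ u ρ ≤
      ENNReal.ofReal (M * ‖boundaryFlux x₀ u G ρ‖)) :
    ∀ᵐ r ∂(volume.restrict (Ioo 0 ρ₀)),
      ((energy x₀ G r).toReal + L * (mass m x₀ u r).toReal) ^ 2 ≤ M ^ 2 * (traceConst N *
        ((mass m x₀ u r).toReal ^ (2 / kExp N m) * ((energy x₀ G r).toReal + r ^ (-nuExp N m) *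
          (mass m x₀ u r).toReal ^ (2 / (m + 1))) ^ (1 - 1 / nuExp N m)) *
        (∫⁻ x, ‖G x‖ₑ ^ 2 ∂(surfaceMeasure x₀ r)).toReal) := by
  have hum : ∀ᵐ r ∂(volume.restrict (Ioo 0 ρ₀)), AEMeasurable u (surfaceMeasure x₀ r) :=
    ae_restrict_Ioo_of_forall_lt fun R hR ↦
      aemeasurable_surfaceMeasure hN x₀ R (h.memLp_ball hR).1.aemeasurable
  have hGm : ∀ᵐ r ∂(volume.restrict (Ioo 0 ρ₀)), AEMeasurable G (surfaceMeasure x₀ r) :=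
    ae_restrict_Ioo_of_forall_lt fun R hR ↦
      aemeasurable_surfaceMeasure hN x₀ R (h.memLp_grad_ball hR).1.aemeasurable
  filter_upwards [hum, hGm, h.ae_sphere_energy_lt_top hN, h.ae_lintegral_surfaceMeasure_le hN hm,
    ae_restrict_of_ae hflux, ae_restrict_mem measurableSet_Ioo] with r h1 h2 h3 h4 h5 hr
  have hfl := enorm_boundaryFlux_sq_le h1 h2
  have h6 := h5 hr
  have hr0 := hr.1
  have hm0 := hm.1
  have hK := traceConst_pos N
  rw [← ENNReal.ofReal_toReal h3.ne] at hfl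
  rw [← ENNReal.ofReal_toReal (h.energy_ne_top hr.2),
    ← ENNReal.ofReal_toReal (h.mass_ne_top hm hr.2)] at h4 h6
  rw [traceBound_ofReal hN hm hr.1 ENNReal.toReal_nonneg ENNReal.toReal_nonneg] at h4
  rw [← ENNReal.ofReal_mul hL.le, ← ENNReal.ofReal_add (by positivity) (by positivity),
    ENNReal.ofReal_le_ofReal_iff (by positivity)] at h6
  have h7 : ‖boundaryFlux x₀ u G r‖ ^ 2 ≤ traceConst N *
        ((mass m x₀ u r).toReal ^ (2 / kExp N m) * ((energy x₀ G r).toReal + r ^ (-nuExp N m) *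
          (mass m x₀ u r).toReal ^ (2 / (m + 1))) ^ (1 - 1 / nuExp N m)) *
        (∫⁻ x, ‖G x‖ₑ ^ 2 ∂(surfaceMeasure x₀ r)).toReal := by
    have := hfl.trans (mul_le_mul_left h4 _)
    rw [← ofReal_norm, ← ENNReal.ofReal_pow (norm_nonneg _),
      ← ENNReal.ofReal_mul (by positivity)] at this
    exact (ENNReal.ofReal_le_ofReal_iff (by positivity)).1 this
  calc _ ≤ (M * ‖boundaryFlux x₀ u G r‖) ^ 2 := by gcongr
    _ = M ^ 2 * ‖boundaryFlux x₀ u G r‖ ^ 2 := mul_pow _ _ _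
    _ ≤ _ := by gcongr

theorem IsH1LocWithGradient.rpow_sub_rpow_le
    (h : IsH1LocWithGradient (ball x₀ ρ₀) u G) (hN : 0 < N) {m : ℝ} (hm : m ∈ Ioo (0 : ℝ) 1)
    {L M : ℝ} (hL : 0 < L) (hM : 0 < M)
    (hflux : ∀ᵐ ρ : ℝ, ρ ∈ Ioo 0 ρ₀ → energy x₀ G ρ + ENNReal.ofReal L * mass m x₀ u ρ ≤
      ENNReal.ofReal (M * ‖boundaryFlux x₀ u G ρ‖))
    (hE₀ : energy x₀ G ρ₀ ≠ ⊤) (hb₀ : mass m x₀ u ρ₀ ≠ ⊤)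
    {a : ℝ} (ha : 0 < a) (haρ : a < ρ₀) (hEa : energy x₀ G a ≠ 0)
    {τ : ℝ} (hτ : τ ∈ Ioc ((m + 1) / 2) 1) :
    gammaExp N m τ * (ρ₀ ^ nuExp N m - a ^ nuExp N m) ≤
      nuExp N m * (traceConst N * M ^ 2 * max 1 (1 / L ^ 2) * max (ρ₀ ^ (nuExp N m - 1)) 1 *
        max ((mass m x₀ u ρ₀).toReal ^ muExp N m τ) ((mass m x₀ u ρ₀).toReal ^ etaExp N m τ)) *
        (energy x₀ G ρ₀).toReal ^ gammaExp N m τ := by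
  have hν := two_lt_nuExp hN hm
  have hγ := gammaExp_mem_Ioo N hm hτ
  have hK := traceConst_pos N
  have hρ₀ : 0 < ρ₀ := ha.trans haρ
  have hEa0 : 0 < (energy x₀ G a).toReal := ENNReal.toReal_pos hEa (h.energy_ne_top haρ)
  set C' := traceConst N * M ^ 2 * max 1 (1 / L ^ 2) * max (ρ₀ ^ (nuExp N m - 1)) 1 *
    max ((mass m x₀ u ρ₀).toReal ^ muExp N m τ) ((mass m x₀ u ρ₀).toReal ^ etaExp N m τ)
  have hC' : 0 ≤ C' := by positivity
  have hdiff := (ae_restrict_iff' measurableSet_Ioo).1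
    (h.ae_energy_add_mass_sq_le hN hm hL hM hflux)
  -- As u is only locally H¹, the inequality is integrated up to R < ρ₀, with E(R) ≤ E(ρ₀) on the
  -- right; then R tends to ρ₀.
  have hR : ∀ R ∈ Ico a ρ₀, gammaExp N m τ * (R ^ nuExp N m - a ^ nuExp N m) ≤
      nuExp N m * C' * (energy x₀ G ρ₀).toReal ^ gammaExp N m τ := by
    intro R hR
    have hR0 : 0 ≤ R := ha.le.trans hR.1
    have hmono : MonotoneOn (fun r ↦ (energy x₀ G r).toReal) (Icc 0 R) := fun x _ y hy hxy ↦
      ENNReal.toReal_mono (h.energy_ne_top (hy.2.trans_lt hR.2)) (energy_mono x₀ G hxy)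
    have key := rpow_sub_rpow_le_of_differential_inequality (ν := nuExp N m) (γ := gammaExp N m τ)
      (C := C') (E := fun r ↦ (energy x₀ G r).toReal) (by linarith) hγ.1 hC' ha hR.1
      (h.intervalIntegrable_sphere_energy hN hR0 hR.2)
      (fun r hr ↦ h.toReal_energy_eq_integral hN hr.1 (hr.2.trans_lt hR.2)) hmono hEa0
      (by
        filter_upwards [hdiff] with r hr hrm
        have hrρ : r < ρ₀ := hrm.2.trans hR.2
        have hr0 : 0 < r := ha.trans hrm.1
        exact rpow_mul_energy_rpow_le hN hm hτ
          (hEa0.trans_le (hmono ⟨ha.le, hR.1⟩ ⟨hr0.le, hrm.2.le⟩ hrm.1.le))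
          ENNReal.toReal_nonneg (ENNReal.toReal_mono hb₀ (mass_mono hm x₀ u hrρ.le)) hr0 hrρ.le hL
          ENNReal.toReal_nonneg hK.le (hr ⟨hr0, hrρ⟩))
    refine key.trans ?_
    have := hγ.1
    have hER : (energy x₀ G R).toReal ≤ (energy x₀ G ρ₀).toReal :=
      ENNReal.toReal_mono hE₀ (energy_mono x₀ G hR.2.le)
    gcongr
  have hlim : Filter.Tendsto (fun R : ℝ ↦ gammaExp N m τ * (R ^ nuExp N m - a ^ nuExp N m))
      (nhdsWithin ρ₀ (Iio ρ₀)) (nhds (gammaExp N m τ * (ρ₀ ^ nuExp N m - a ^ nuExp N m))) := by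
    refine Filter.Tendsto.mono_left (Continuous.tendsto ?_ ρ₀) nhdsWithin_le_nhds
    exact continuous_const.mul ((Real.continuous_rpow_const (by linarith)).sub continuous_const)
  refine le_of_tendsto hlim ?_
  filter_upwards [Ico_mem_nhdsLT haρ] with R hRm using hR R hRm

/-- The constant in the localization estimate. -/
noncomputable def localizationConst (N : ℕ) : ℝ := (N + 2) * (N + 4) * traceConst N

theorem localizationConst_pos (N : ℕ) : 0 < localizationConst N := by
  have := traceConst_pos N
  unfold localizationConst
  positivity

theorem nuExp_mul_kExp_le (N : ℕ) {m : ℝ} (hm : m ∈ Ioo (0 : ℝ) 1) :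
    nuExp N m * kExp N m ≤ (N + 2) * (N + 4) := by
  have h1 : kExp N m ≤ N + 4 := by
    rw [kExp]
    nlinarith [hm.1, hm.2, mul_nonneg (Nat.cast_nonneg (α := ℝ) N) hm.1.le]
  exact mul_le_mul (nuExp_le N hm) h1 (kExp_pos N hm).le (by positivity)

/-- If E(a) were positive, the integrated inequality at the minimising τ would give ρ_max ≤ a.
Nonzero mass excludes the product 0 · ∞: when E or b is infinite the minimum is then infinite and
the truncated difference is 0. -/
theorem IsH1LocWithGradient.energy_eq_zero_of_lt_rhoMax
    (h : IsH1LocWithGradient (ball x₀ ρ₀) u G) (hN : 0 < N) {m : ℝ} (hm : m ∈ Ioo (0 : ℝ) 1)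
    {L M : ℝ} (hL : 0 < L) (hM : 0 < M)
    (hflux : ∀ᵐ ρ : ℝ, ρ ∈ Ioo 0 ρ₀ → energy x₀ G ρ + ENNReal.ofReal L * mass m x₀ u ρ ≤
      ENNReal.ofReal (M * ‖boundaryFlux x₀ u G ρ‖))
    (hb₀ : mass m x₀ u ρ₀ ≠ 0) {a : ℝ} (ha : 0 < a) (haρ : a < ρ₀)
    (harho : a < rhoMax N m (localizationConst N) ρ₀ L M (energy x₀ G ρ₀) (mass m x₀ u ρ₀)) :
    energy x₀ G a = 0 := by
  by_contra hEa
  refine harho.not_ge ?_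
  have hν := two_lt_nuExp hN hm
  have hρ₀ : 0 < ρ₀ := ha.trans haρ
  have hC := localizationConst_pos N
  obtain ⟨τ, hτ, hmin⟩ := exists_isMinOn_tauTerm (N := N) hm (energy x₀ G ρ₀) (mass m x₀ u ρ₀)
  have hinf : ⨅ τ ∈ Ioc ((m + 1) / 2) 1, tauTerm N m (energy x₀ G ρ₀) (mass m x₀ u ρ₀) τ =
      tauTerm N m (energy x₀ G ρ₀) (mass m x₀ u ρ₀) τ :=
    le_antisymm (iInf₂_le τ hτ) (le_iInf₂ fun x hx ↦ hmin hx)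
  set c := localizationConst N * M ^ 2 * max 1 (1 / L ^ 2) * max (ρ₀ ^ (nuExp N m - 1)) 1 with hc
  have hc0 : 0 < c := by positivity
  have hsub : ENNReal.ofReal (ρ₀ ^ nuExp N m) - ENNReal.ofReal c *
      tauTerm N m (energy x₀ G ρ₀) (mass m x₀ u ρ₀) τ ≤ ENNReal.ofReal (a ^ nuExp N m) := by
    have hE₀ : energy x₀ G ρ₀ ≠ 0 := fun h0 ↦
      hEa (le_antisymm ((energy_mono x₀ G haρ.le).trans h0.le) zero_le)
    by_cases htop : energy x₀ G ρ₀ = ⊤ ∨ mass m x₀ u ρ₀ = ⊤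
    · rw [tauTerm_eq_top hm hτ hE₀ hb₀ htop, ENNReal.mul_top (by simpa using hc0)]
      simp
    push Not at htop
    have key := h.rpow_sub_rpow_le hN hm hL hM hflux htop.1 htop.2 ha haρ hEa hτ
    rw [← ENNReal.ofReal_toReal htop.1, ← ENNReal.ofReal_toReal htop.2,
      tauTerm_ofReal hm hτ ENNReal.toReal_nonneg ENNReal.toReal_nonneg,
      ← ENNReal.ofReal_mul hc0.le, tsub_le_iff_right]
    have hτ0 : 0 < 2 * τ - (1 + m) := by linarith [hτ.1]
    rw [← ENNReal.ofReal_add (by positivity) (by positivity)]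
    refine ENNReal.ofReal_le_ofReal ?_
    have hk := kExp_pos N hm
    have hK := traceConst_pos N
    set B := max ((mass m x₀ u ρ₀).toReal ^ muExp N m τ) ((mass m x₀ u ρ₀).toReal ^ etaExp N m τ)
    have hB : 0 ≤ B := by positivity
    set F := (energy x₀ G ρ₀).toReal ^ gammaExp N m τ
    have hF : 0 ≤ F := by positivity
    have h1 : ρ₀ ^ nuExp N m - a ^ nuExp N m ≤ c * (F * B / (2 * τ - (1 + m))) := by
      rw [gammaExp, div_mul_eq_mul_div, div_le_iff₀ hk] at key
      rw [← mul_div_assoc, le_div_iff₀ hτ0, mul_comm]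
      refine key.trans ?_
      calc _ = (nuExp N m * kExp N m) * (traceConst N * M ^ 2 * max 1 (1 / L ^ 2) *
              max (ρ₀ ^ (nuExp N m - 1)) 1 * (F * B)) := by ring
        _ ≤ ((N + 2) * (N + 4)) * (traceConst N * M ^ 2 * max 1 (1 / L ^ 2) *
              max (ρ₀ ^ (nuExp N m - 1)) 1 * (F * B)) := by
            gcongr ?_ * _
            exact nuExp_mul_kExp_le N hm
        _ = _ := by
            rw [hc, localizationConst]
            ring
    linarith
  rw [rhoMax, hinf, ← hc]
  calc _ ≤ (a ^ nuExp N m) ^ (1 / nuExp N m) := by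
        refine Real.rpow_le_rpow ENNReal.toReal_nonneg ?_ (by positivity)
        exact ENNReal.toReal_le_of_le_ofReal (by positivity) hsub
    _ = a := by
        rw [← Real.rpow_mul ha.le, mul_one_div_cancel (by linarith), Real.rpow_one]

theorem ae_eq_zero_of_mass_eq_zero {m : ℝ} (hm : m ∈ Ioo (0 : ℝ) 1) {r : ℝ}
    (hu : AEStronglyMeasurable u (volume.restrict (ball x₀ r))) (h : mass m x₀ u r = 0) :
    ∀ᵐ x ∂(volume.restrict (ball x₀ r)), u x = 0 := by
  have hm1 : 0 < m + 1 := by linarith [hm.1]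
  rw [mass, ENNReal.rpow_eq_zero_iff_of_pos hm1, eLpNorm_eq_zero_iff hu (by simpa using hm1)] at h
  exact h

/-- Zero energy makes G vanish σ-almost everywhere on almost every sphere, so the flux there is zero
and the hypothesis forces zero mass. Monotonicity transfers this from one good radius in (c,a) to c.
-/
theorem mass_eq_zero_of_energy_eq_zero (hN : 0 < N) {m : ℝ} (hm : m ∈ Ioo (0 : ℝ) 1)
    {L M : ℝ} (hL : 0 < L) {c a : ℝ} (hc : c < a) (ha : a ≤ ρ₀)
    (hflux : ∀ᵐ ρ : ℝ, ρ ∈ Ioo 0 ρ₀ → energy x₀ G ρ + ENNReal.ofReal L * mass m x₀ u ρ ≤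
      ENNReal.ofReal (M * ‖boundaryFlux x₀ u G ρ‖))
    (hG : AEStronglyMeasurable G (volume.restrict (ball x₀ a))) (hE : energy x₀ G a = 0)
    (ha0 : 0 < a) : mass m x₀ u c = 0 := by
  have hG0 : ∀ᵐ x ∂(volume.restrict (ball x₀ a)), G x = 0 := by
    rw [energy, pow_eq_zero_iff two_ne_zero, eLpNorm_eq_zero_iff hG two_ne_zero] at hE
    exact hE
  have h1 : ∀ᵐ r : ℝ, r ∈ Ioo 0 a → mass m x₀ u r = 0 := by
    have h2 := (ae_restrict_iff' measurableSet_Ioo).1 (ae_surfaceMeasure_of_ae_ball hN x₀ a hG0)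
    filter_upwards [h2, hflux] with r h2 h3 hr
    have hfl : boundaryFlux x₀ u G r = 0 := by
      rw [boundaryFlux]
      refine integral_eq_zero_of_ae ?_
      filter_upwards [h2 hr] with x hx
      simp [hx]
    have h4 := h3 ⟨hr.1, hr.2.trans_le ha⟩
    rw [hfl, norm_zero, mul_zero, ENNReal.ofReal_zero, nonpos_iff_eq_zero, add_eq_zero,
      mul_eq_zero] at h4
    exact h4.2.resolve_left (by simpa using hL)
  obtain ⟨r, hr, hr'⟩ : ∃ r ∈ Ioo (max 0 c) a, mass m x₀ u r = 0 := by
    by_contra! hne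
    have h3 : volume (Ioo (max 0 c) a) = 0 := by
      refine measure_mono_null (fun r hr ↦ ?_) h1
      simp only [mem_compl_iff, mem_ofPred_eq, not_forall]
      exact ⟨⟨(le_max_left _ _).trans_lt hr.1, hr.2⟩, hne r hr⟩
    rw [Real.volume_Ioo, ENNReal.ofReal_eq_zero, sub_nonpos] at h3
    exact h3.not_gt (max_lt ha0 hc)
  exact le_antisymm ((mass_mono hm x₀ u ((le_max_right 0 c).trans hr.1.le)).trans hr'.le) zero_le

theorem rhoMax_le {m C L M : ℝ} {E b : ℝ≥0∞} (hN : 0 < N) (hm : m ∈ Ioo (0 : ℝ) 1)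
    (hρ₀ : 0 < ρ₀) : rhoMax N m C ρ₀ L M E b ≤ ρ₀ := by
  have hν := two_lt_nuExp hN hm
  rw [rhoMax]
  calc _ ≤ (ρ₀ ^ nuExp N m) ^ (1 / nuExp N m) :=
        Real.rpow_le_rpow ENNReal.toReal_nonneg
          (ENNReal.toReal_le_of_le_ofReal (by positivity) tsub_le_self) (by positivity)
    _ = ρ₀ := by
        rw [← Real.rpow_mul hρ₀.le, mul_one_div_cancel (by linarith), Real.rpow_one]

theorem IsH1LocWithGradient.ae_eq_zero_ball_rhoMax
    (h : IsH1LocWithGradient (ball x₀ ρ₀) u G) (hN : 0 < N) (hρ₀ : 0 < ρ₀) {m : ℝ}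
    (hm : m ∈ Ioo (0 : ℝ) 1) {L M : ℝ} (hL : 0 < L) (hM : 0 < M)
    (hflux : ∀ᵐ ρ : ℝ, ρ ∈ Ioo 0 ρ₀ → energy x₀ G ρ + ENNReal.ofReal L * mass m x₀ u ρ ≤
      ENNReal.ofReal (M * ‖boundaryFlux x₀ u G ρ‖)) :
    ∀ᵐ x ∂(volume.restrict (ball x₀ (rhoMax N m (localizationConst N) ρ₀ L M (energy x₀ G ρ₀)
      (mass m x₀ u ρ₀)))), u x = 0 := by
  have hle := rhoMax_le (C := localizationConst N) (L := L) (M := M) (E := energy x₀ G ρ₀)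
    (b := mass m x₀ u ρ₀) hN hm hρ₀
  refine ae_restrict_ball_of_forall_lt fun c hc ↦ ?_
  refine ae_eq_zero_of_mass_eq_zero hm (h.memLp_ball (hc.trans_le hle)).1 ?_
  -- Zero total mass already gives the conclusion, and it is the case excluded from the energy
  -- argument.
  by_cases hb₀ : mass m x₀ u ρ₀ = 0
  · exact le_antisymm ((mass_mono hm x₀ u (hc.trans_le hle).le).trans hb₀.le) zero_le
  rcases le_or_gt c 0 with hc0 | hc0
  · rw [mass_eq_lintegral hm, ball_eq_empty.2 hc0]
    simp
  obtain ⟨a, hca, ha⟩ := exists_between hc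
  have haρ : a < ρ₀ := ha.trans_le hle
  exact mass_eq_zero_of_energy_eq_zero hN hm hL hca haρ.le hflux (h.memLp_grad_ball haρ).1
    (h.energy_eq_zero_of_lt_rhoMax hN hm hL hM hflux hb₀ (hc0.trans hca) haρ ha) (hc0.trans hca)

end VanishingRadius

end Localization

theorem theorem2p1 (N : ℕ) (hN : 0 < N) :
    (∀ m ∈ Ioo (0 : ℝ) 1, 2 < Localization.nuExp N m ∧
      ∀ τ ∈ Ioc ((m + 1) / 2) 1,
        Localization.gammaExp N m τ ∈ Ioo (0 : ℝ) 1 ∧ 0 < Localization.etaExp N m τ) ∧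
    ∃ C : ℝ → ℝ, ContinuousOn C (Ioo 0 1) ∧ (∀ m ∈ Ioo (0 : ℝ) 1, 0 < C m) ∧
      ∀ m ∈ Ioo (0 : ℝ) 1, ∀ (x₀ : EuclideanSpace ℝ (Fin N)) (ρ₀ : ℝ), 0 < ρ₀ →
      ∀ (u : EuclideanSpace ℝ (Fin N) → ℂ)
        (G : EuclideanSpace ℝ (Fin N) → EuclideanSpace ℂ (Fin N)),
        Localization.IsH1LocWithGradient (ball x₀ ρ₀) u G →
      ∀ L M : ℝ, 0 < L → 0 < M →
        (∀ᵐ ρ : ℝ, ρ ∈ Ioo 0 ρ₀ →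
          Localization.energy x₀ G ρ + ENNReal.ofReal L * Localization.mass m x₀ u ρ ≤
            ENNReal.ofReal (M * ‖Localization.boundaryFlux x₀ u G ρ‖)) →
        (∃ τ₀ ∈ Ioc ((m + 1) / 2) 1,
          IsMinOn (Localization.tauTerm N m (Localization.energy x₀ G ρ₀)
            (Localization.mass m x₀ u ρ₀)) (Ioc ((m + 1) / 2) 1) τ₀) ∧
        ∀ᵐ x ∂(volume.restrict (ball x₀ (Localization.rhoMax N m (C m) ρ₀ L M
          (Localization.energy x₀ G ρ₀) (Localization.mass m x₀ u ρ₀)))), u x = 0 := by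
  refine ⟨fun m hm ↦ ⟨Localization.two_lt_nuExp hN hm, fun τ hτ ↦
    ⟨Localization.gammaExp_mem_Ioo N hm hτ, Localization.etaExp_pos N hm hτ.2⟩⟩,
    -- The constant does not depend on m, so its continuity in m is immediate.
    fun _ ↦ Localization.localizationConst N, continuousOn_const,
    fun _ _ ↦ Localization.localizationConst_pos N, ?_⟩
  intro m hm x₀ ρ₀ hρ₀ u G h L M hL hM hflux
  exact ⟨Localization.exists_isMinOn_tauTerm hm _ _,
    h.ae_eq_zero_ball_rhoMax hN hρ₀ hm hL hM hflux⟩
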